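/- Let $\Pi=\{s\in\mathbb C:\operatorname{Re}s>0\}$, let $H^\infty(\Pi)$ be the space of bounded holomorphic functions on $\Pi$ with norm $\|f\|=\sup_{s\in\Pi}|f(s)|$, and let $\Omega(n)$ be the number of prime factors of $n$ counted with multiplicity. Call a real number $\sigma$ admissible if for every $f\in H^\infty(\Pi)$ with $\|f\|=1$ that is the sum of a Dirichlet series $f(s)=\sum_{n\ge1}a_nn^{-s}$ converging at every point of $\Pi$ one has $$|a_1|^2+\sum_{n=2}^\infty\frac{|a_n|}{n^\sigma}\le 1 .$$ (a) The equation $$\sum_{k=1}^\infty\Bigl(\sum_{n\ge2,\ \Omega(n)=k}\frac1{n^{2\sigma}}\Bigr)^{1/2}=1$$ has exactly one real solution $\sigma_0$; it satisfies $\sigma_0<1.2063$, and $\sigma_0$ is admissible. (b) There is a smallest admissible exponent $\sigma_{\rm opt}$, and $1\le\sigma_{\rm opt}<1.2061$. (c) If only series of the form $f(s)=\sum_{k\ge0}c_k2^{-ks}$ (that is, $a_n=0$ unless $n$ is a power of $2$) are considered in the definition of admissibility, then the smallest admissible exponent is exactly $1$. -/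

import Mathlib

/-- The open right half-plane `Π = {s : Re s > 0}`. -/
def rightHalfPlane : Set ℂ := {s : ℂ | 0 < s.re}

/-- `f ∈ H^∞(Π)`: `f` is holomorphic and bounded on the right half-plane. -/
structure MemHInfty (f : ℂ → ℂ) : Prop where
  holomorphic : DifferentiableOn ℂ f rightHalfPlane
  bounded : BddAbove ((fun s => ‖f s‖) '' rightHalfPlane)

/-- `‖f‖ = sup_{s ∈ Π} |f s|`; only used together with `MemHInfty f`. -/
noncomputable def hInftyNorm (f : ℂ → ℂ) : ℝ :=
  sSup ((fun s => ‖f s‖) '' rightHalfPlane)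

/-- The ordinary Dirichlet series `∑_{n ≥ 1} a n / n ^ s` converges (possibly only conditionally)
to `f s` at every point `s` of the right half-plane. The value `a 0` plays no role. -/
def IsDirichletSeriesOf (a : ℕ → ℂ) (f : ℂ → ℂ) : Prop :=
  ∀ s ∈ rightHalfPlane,
    Filter.Tendsto (fun N : ℕ => ∑ n ∈ Finset.Icc 1 N, a n / (n : ℂ) ^ s)
      Filter.atTop (nhds (f s))

/-- The inequality `|a₁|² + ∑_{n ≥ 2} |a_n| n^{-σ} ≤ 1`, convergence of the series included. -/
def SquareBohrInequality (a : ℕ → ℂ) (σ : ℝ) : Prop :=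
  Summable (fun n : ℕ => ‖a (n + 2)‖ * ((n + 2 : ℕ) : ℝ) ^ (-σ)) ∧
    ‖a 1‖ ^ 2 + ∑' n : ℕ, ‖a (n + 2)‖ * ((n + 2 : ℕ) : ℝ) ^ (-σ) ≤ 1

/-- The exponents `σ` for which the inequality holds for all Dirichlet series in `H^∞(Π)` of
norm one. -/
def admissibleExponents : Set ℝ :=
  {σ : ℝ | ∀ (a : ℕ → ℂ) (f : ℂ → ℂ), MemHInfty f → IsDirichletSeriesOf a f →
    hInftyNorm f = 1 → SquareBohrInequality a σ}

/-- The same, with only the series `∑_{k ≥ 0} a_{2^k} 2^{-ks}`, i.e. power series in `2^{-s}`,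
taken into account. -/
def admissibleExponentsPowersOfTwo : Set ℝ :=
  {σ : ℝ | ∀ (a : ℕ → ℂ) (f : ℂ → ℂ), MemHInfty f → IsDirichletSeriesOf a f →
    (∀ n : ℕ, (∀ k : ℕ, n ≠ 2 ^ k) → a n = 0) →
    hInftyNorm f = 1 → SquareBohrInequality a σ}

/-- `∑_{k ≥ 1} (∑_{n ≥ 2, Ω(n) = k} n^{-2σ})^{1/2}`, with value in `[0, ∞]`, where `Ω(n)` is the
number of prime factors of `n` counted with multiplicity. -/
noncomputable def omegaBlockSum (σ : ℝ) : ENNReal :=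
  ∑' k : ℕ,
    (∑' n : {n : ℕ // 2 ≤ n ∧ ArithmeticFunction.cardFactors n = k + 1},
      ENNReal.ofReal (((n : ℕ) : ℝ) ^ (-2 * σ))) ^ (1 / 2 : ℝ)

open Filter MeasureTheory ProbabilityTheory Topology ComplexConjugate
open scoped ArithmeticFunction.Omega

/-! Everything is extracted from one operator bound. As |f| ≤ 1 on the half-plane, multiplication by
f contracts the Hilbert space of Dirichlet series with square-summable coefficients; in terms of
coefficients, Dirichlet convolution by a is a contraction of ℓ²
(`IsDirichletSeriesOf.norm_sum_dvd_le`). This comes from averaging over vertical lines against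
Gaussians of growing variance, for which the functions n^{-it} become orthonormal.

Since Ω is additive, it grades ℓ², and convolution by a is block triangular with a₁ times the
identity on the diagonal. In such a contraction every off-diagonal block has norm at most 1 - |a₁|²
(`IsConvContraction.sum_norm_sq_sum_le`), which generalises Wiener's |c_k| ≤ 1 - |c₀|² for power
series. Applied to the unit vector at 1 it bounds the ℓ² norm of (a_n) over Ω(n) = k, and Cauchy's
inequality bounds the k-th part of the Bohr sum by (1 - |a₁|²)(∑ n^{-2σ})^{1/2}. So σ is admissible
as soon as the block sum is at most 1. Raising σ by r ≥ 0 multiplies the block sum by at most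
2^{-r}, and the block sum is continuous for σ ≥ 1, so it equals 1 exactly once; an integer
certificate shows it is below 1 at 345/286 < 1.2063.

For (b), the block from level 1 to level 2 is applied to the vector (a₂, a₃). The entry 2a₂a₃ at
index 6 is larger than the plain ℓ² bound accounts for; this improves the prime block enough to make
6/5 admissible (`IsConvContraction.sum_prime_le`). The admissible set is bounded below by (c) and
contains its infimum.

For (c), a block is a single coefficient, bounded by 1 - |a₁|², and ∑ 2^{-k} = 1. The Möbius
functions (A - 2^{-s})/(1 - A 2^{-s}) exclude smaller exponents. -/

/-! ### Coefficients of a Dirichlet series as Gaussian means along vertical lines -/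

lemma norm_cpow_neg_sub_cpow_neg_le {w : ℂ} (hw : 0 < w.re) {x y : ℝ} (hx : 0 < x) (hxy : x ≤ y) :
    ‖(x : ℂ) ^ (-w) - (y : ℂ) ^ (-w)‖ ≤ ‖w‖ / w.re * (x ^ (-w.re) - y ^ (-w.re)) := by
  have h0 : (0 : ℝ) ∉ Set.uIcc x y := by
    rw [Set.uIcc_of_le hxy]; exact fun h => absurd h.1 (not_le.mpr hx)
  have hw0 : w ≠ 0 := by rintro rfl; simp at hw
  have h1 : ∫ u in x..y, (u : ℂ) ^ (-w - 1) = ((x : ℂ) ^ (-w) - (y : ℂ) ^ (-w)) / w := by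
    rw [integral_cpow (Or.inr ⟨by simpa using hw0, h0⟩)]
    simp only [sub_add_cancel]
    field_simp
    ring
  have h2 : ∫ u in x..y, u ^ (-w.re - 1) = (x ^ (-w.re) - y ^ (-w.re)) / w.re := by
    rw [integral_rpow (Or.inr ⟨by linarith, h0⟩)]
    simp only [sub_add_cancel]
    field_simp
    ring
  have h3 : ‖∫ u in x..y, (u : ℂ) ^ (-w - 1)‖ ≤ ∫ u in x..y, u ^ (-w.re - 1) := by
    refine intervalIntegral.norm_integral_le_of_norm_le hxy (ae_of_all _ fun u hu => ?_) ?_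
    · rw [Complex.norm_cpow_eq_rpow_re_of_pos (hx.trans hu.1)]; simp
    · exact intervalIntegral.intervalIntegrable_rpow (Or.inr h0)
  rw [h1, h2, norm_div, div_le_iff₀ (norm_pos_iff.mpr hw0)] at h3
  calc _ ≤ _ := h3
    _ = _ := by ring

/-- Abel summation: the factor |w| / Re w is the price for comparing the total variation of n^{-w}
with the telescoping one of n^{-Re w}. -/
lemma norm_sum_mul_cpow_neg_le {b : ℕ → ℂ} {C : ℝ}
    (hC : ∀ N, ‖∑ n ∈ Finset.range N, b (n + 1)‖ ≤ C) {w : ℂ} (hw : 0 < w.re) (N : ℕ) :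
    ‖∑ n ∈ Finset.range N, b (n + 1) * (((n + 1 : ℕ) : ℝ) : ℂ) ^ (-w)‖ ≤ C * (1 + ‖w‖ / w.re) := by
  have hC0 : 0 ≤ C := (norm_nonneg _).trans (hC 0)
  rcases N with _ | N
  · simp; positivity
  set g : ℕ → ℂ := fun n => (((n + 1 : ℕ) : ℝ) : ℂ) ^ (-w) with hg
  set r : ℕ → ℝ := fun n => ((n + 1 : ℕ) : ℝ) ^ (-w.re) with hr
  have key : ∀ N, ∑ n ∈ Finset.range (N + 1), b (n + 1) * g n
      = (∑ n ∈ Finset.range (N + 1), b (n + 1)) * g N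
        + ∑ n ∈ Finset.range N, (∑ i ∈ Finset.range (n + 1), b (i + 1)) * (g n - g (n + 1)) := by
    intro N
    induction N with
    | zero => simp
    | succ N ih =>
      rw [Finset.sum_range_succ, ih, Finset.sum_range_succ (fun n => b (n + 1)) (N + 1),
        Finset.sum_range_succ (fun n => (∑ i ∈ Finset.range (n + 1), b (i + 1)) *
          (g n - g (n + 1))) N]
      ring
  have hgr : ∀ n, ‖g n‖ = r n := fun n => by
    rw [hg]; simp only
    rw [Complex.norm_cpow_eq_rpow_re_of_pos (by positivity)]; simp [hr]
  have hr1 : ∀ n, r n ≤ 1 := fun n => by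
    apply Real.rpow_le_one_of_one_le_of_nonpos
    · push_cast; linarith [Nat.cast_nonneg (α := ℝ) n]
    · linarith
  have hr0 : ∀ n, 0 ≤ r n := fun n => by positivity
  have hd : ∀ n, ‖g n - g (n + 1)‖ ≤ ‖w‖ / w.re * (r n - r (n + 1)) := fun n =>
    norm_cpow_neg_sub_cpow_neg_le hw (by positivity) (by push_cast; linarith)
  have hq : 0 ≤ ‖w‖ / w.re := by positivity
  calc ‖∑ n ∈ Finset.range (N + 1), b (n + 1) * g n‖
      ≤ ‖(∑ n ∈ Finset.range (N + 1), b (n + 1)) * g N‖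
        + ∑ n ∈ Finset.range N, ‖(∑ i ∈ Finset.range (n + 1), b (i + 1)) * (g n - g (n + 1))‖ := by
        rw [key]; exact (norm_add_le _ _).trans (by gcongr; exact norm_sum_le _ _)
    _ ≤ C * 1 + ∑ n ∈ Finset.range N, C * (‖w‖ / w.re * (r n - r (n + 1))) := by
        gcongr with n _
        · rw [norm_mul]
          exact mul_le_mul (hC _) ((hgr N).le.trans (hr1 N)) (norm_nonneg _) hC0
        · rw [norm_mul]
          exact mul_le_mul (hC _) (hd n) (norm_nonneg _) hC0
    _ = C * (1 + ‖w‖ / w.re * (r 0 - r N)) := by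
        rw [← Finset.mul_sum, ← Finset.mul_sum, Finset.sum_range_sub']; ring
    _ ≤ C * (1 + ‖w‖ / w.re) := by
        have := hr1 0; have := hr0 N
        gcongr
        nlinarith

lemma sum_Icc_one_eq_sum_range {M : Type*} [AddCommMonoid M] (F : ℕ → M) (N : ℕ) :
    ∑ n ∈ Finset.Icc 1 N, F n = ∑ n ∈ Finset.range N, F (n + 1) := by
  rw [Finset.range_eq_Ico, Finset.sum_Ico_add' F 0 N 1]
  rfl

lemma IsDirichletSeriesOf.tendsto_range {a : ℕ → ℂ} {f : ℂ → ℂ} (h : IsDirichletSeriesOf a f)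
    {s : ℂ} (hs : 0 < s.re) :
    Tendsto (fun N : ℕ => ∑ n ∈ Finset.range N, a (n + 1) * (((n + 1 : ℕ) : ℝ) : ℂ) ^ (-s))
      atTop (𝓝 (f s)) := by
  have := h s hs
  simp_rw [sum_Icc_one_eq_sum_range] at this
  simpa only [Complex.cpow_neg, div_eq_mul_inv, Complex.ofReal_natCast] using this

lemma exists_norm_le_of_tendsto {E : Type*} [NormedAddCommGroup E] {u : ℕ → E} {l : E}
    (h : Tendsto u atTop (𝓝 l)) : ∃ C, ∀ n, ‖u n‖ ≤ C := by
  obtain ⟨C, hC⟩ := h.norm.bddAbove_range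
  exact ⟨C, fun n => hC ⟨n, rfl⟩⟩

/-- The partial sums of a Dirichlet series converging on the half-plane grow at most linearly
along vertical lines. -/
lemma IsDirichletSeriesOf.exists_norm_sum_le {a : ℕ → ℂ} {f : ℂ → ℂ}
    (h : IsDirichletSeriesOf a f) {δ : ℝ} (hδ : 0 < δ) :
    ∃ C : ℝ, ∀ (N : ℕ) (t : ℝ),
      ‖∑ n ∈ Finset.range N, a (n + 1) * (((n + 1 : ℕ) : ℝ) : ℂ) ^ (-((δ : ℂ) + t * Complex.I))‖
        ≤ C * (1 + |t|) := by
  -- Convergence at the single point δ/2 bounds the partial sums there; the remaining shift δ/2 + it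
  -- has constant real part, so |w| / Re w is linear in |t|.
  obtain ⟨C, hC⟩ := exists_norm_le_of_tendsto
    (h.tendsto_range (s := ((δ / 2 : ℝ) : ℂ)) (by simpa using hδ))
  have hC0 : 0 ≤ C := (norm_nonneg _).trans (hC 0)
  refine ⟨C * (2 + 2 / δ), fun N t => ?_⟩
  have hw : 0 < (((δ / 2 : ℝ) : ℂ) + t * Complex.I).re := by simpa using hδ
  have := norm_sum_mul_cpow_neg_le (b := fun n => a n * ((n : ℝ) : ℂ) ^ (-((δ / 2 : ℝ) : ℂ)))
    hC hw N
  have hre : (((δ / 2 : ℝ) : ℂ) + t * Complex.I).re = δ / 2 := by simp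
  have hn : ‖((δ / 2 : ℝ) : ℂ) + t * Complex.I‖ ≤ δ / 2 + |t| := by
    refine (norm_add_le _ _).trans ?_
    simp [abs_of_pos hδ]
  calc _ = _ := by
        congr 1
        refine Finset.sum_congr rfl fun n _ => ?_
        rw [mul_assoc, ← Complex.cpow_add _ _ (by exact_mod_cast Nat.succ_ne_zero n)]
        congr 2
        push_cast
        ring
    _ ≤ _ := this
    _ ≤ C * (1 + (δ / 2 + |t|) / (δ / 2)) := by rw [hre]; gcongr
    _ ≤ C * (2 + 2 / δ) * (1 + |t|) := by
        rw [mul_assoc]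
        gcongr
        rw [add_div, div_self (by positivity)]
        have e : |t| / (δ / 2) = 2 / δ * |t| := by field_simp
        rw [e]
        have : 0 ≤ 2 / δ := by positivity
        nlinarith [abs_nonneg t]

lemma integral_cexp_mul_I_gaussianReal (v : NNReal) (x : ℝ) :
    ∫ t : ℝ, Complex.exp (x * t * Complex.I) ∂(gaussianReal 0 v)
      = ((Real.exp (-(v * x ^ 2 / 2)) : ℝ) : ℂ) := by
  rw [← charFun_apply_real, charFun_gaussianReal]
  push_cast
  congr 1
  simp

lemma natCast_cpow_neg_vertical {n : ℕ} (hn : 0 < n) (δ t : ℝ) :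
    ((n : ℝ) : ℂ) ^ (-((δ : ℂ) + t * Complex.I))
      = (((n : ℝ) ^ (-δ) : ℝ) : ℂ) * Complex.exp ((-Real.log n : ℝ) * t * Complex.I) := by
  have hn' : ((n : ℝ) : ℂ) ≠ 0 := by exact_mod_cast hn.ne'
  rw [Complex.ofReal_cpow (by positivity), neg_add, Complex.cpow_add _ _ hn',
    Complex.cpow_def_of_ne_zero hn' (-(t * Complex.I)), ← Complex.ofReal_log (by positivity)]
  push_cast
  congr 2
  ring

/-- Gaussian means of `f` along a vertical line against a character. -/
lemma IsDirichletSeriesOf.tendsto_integral_gaussian {a : ℕ → ℂ} {f : ℂ → ℂ}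
    (h : IsDirichletSeriesOf a f) {δ : ℝ} (hδ : 0 < δ) (v : NNReal) (x : ℝ) :
    Tendsto (fun N : ℕ => ∑ n ∈ Finset.range N, a (n + 1) * (((n + 1 : ℕ) : ℝ) ^ (-δ) : ℝ) *
        ((Real.exp (-(v * (x - Real.log (n + 1 : ℕ)) ^ 2 / 2)) : ℝ) : ℂ)) atTop
      (𝓝 (∫ t : ℝ, f ((δ : ℂ) + t * Complex.I) * Complex.exp (x * t * Complex.I)
        ∂(gaussianReal 0 v))) := by
  obtain ⟨C, hC⟩ := h.exists_norm_sum_le hδ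
  have hnorm : ∀ y t : ℝ, ‖Complex.exp (y * t * Complex.I)‖ = 1 := fun y t => by
    rw [← Complex.ofReal_mul, Complex.norm_exp_ofReal_mul_I]
  have hint : ∀ y : ℝ, Integrable (fun t : ℝ => Complex.exp (y * t * Complex.I))
      (gaussianReal 0 v) := fun y => by
    refine Integrable.of_bound (C := 1) ?_ (ae_of_all _ fun t => (hnorm y t).le)
    exact Continuous.aestronglyMeasurable (by fun_prop)
  have hF : ∀ N (t : ℝ), (∑ n ∈ Finset.range N, a (n + 1) *
        (((n + 1 : ℕ) : ℝ) : ℂ) ^ (-((δ : ℂ) + t * Complex.I))) * Complex.exp (x * t * Complex.I)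
      = ∑ n ∈ Finset.range N, a (n + 1) * (((n + 1 : ℕ) : ℝ) ^ (-δ) : ℝ) *
        Complex.exp ((x - Real.log (n + 1 : ℕ) : ℝ) * t * Complex.I) := by
    intro N t
    rw [Finset.sum_mul]
    refine Finset.sum_congr rfl fun n _ => ?_
    rw [natCast_cpow_neg_vertical (Nat.succ_pos n), ← mul_assoc, mul_assoc _ _ (Complex.exp _),
      ← Complex.exp_add]
    congr 2
    push_cast
    ring
  have key : Tendsto (fun N : ℕ => ∫ t : ℝ, (∑ n ∈ Finset.range N, a (n + 1) *
        (((n + 1 : ℕ) : ℝ) : ℂ) ^ (-((δ : ℂ) + t * Complex.I))) * Complex.exp (x * t * Complex.I)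
        ∂(gaussianReal 0 v)) atTop
      (𝓝 (∫ t : ℝ, f ((δ : ℂ) + t * Complex.I) * Complex.exp (x * t * Complex.I)
        ∂(gaussianReal 0 v))) := by
    -- The series may converge only conditionally, so the limit is exchanged through the linear
    -- bound on the partial sums, which a Gaussian integrates.
    refine tendsto_integral_of_dominated_convergence (fun t => C * (1 + |t|)) ?_ ?_ ?_ ?_
    · intro N
      simp_rw [hF]
      exact Continuous.aestronglyMeasurable (by fun_prop)
    · have : Integrable (fun t : ℝ => t) (gaussianReal 0 v) :=
        memLp_one_iff_integrable.mp (memLp_id_gaussianReal 1)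
      exact ((integrable_const (1 : ℝ)).add this.abs).const_mul C
    · intro N
      refine ae_of_all _ fun t => ?_
      rw [norm_mul, hnorm, mul_one]
      exact hC N t
    · refine ae_of_all _ fun t => ?_
      exact (h.tendsto_range (by simpa using hδ)).mul_const _
  refine key.congr fun N => ?_
  simp_rw [hF]
  rw [integral_finsetSum _ fun n _ => (hint _).const_mul _]
  refine Finset.sum_congr rfl fun n _ => ?_
  rw [integral_const_mul, integral_cexp_mul_I_gaussianReal]

/-- A Gaussian in log n decays faster than any power of n. Exponent 2 suffices to make the
Gaussian-weighted series absolutely convergent, uniformly in the variance. -/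
lemma exp_neg_sq_sub_log_le (x : ℝ) {n : ℕ} (hn : 0 < n) :
    Real.exp (-((x - Real.log n) ^ 2 / 2)) ≤ Real.exp (2 * x + 2) * (n : ℝ) ^ (-2 : ℝ) := by
  rw [Real.rpow_def_of_pos (by positivity), ← Real.exp_add]
  apply Real.exp_le_exp.mpr
  nlinarith [sq_nonneg (Real.log n - x - 2)]

/-- Gaussian means of `f`, of increasing variance, against the character of frequency `x`
single out the coefficient of index `exp x`. -/
lemma IsDirichletSeriesOf.tendsto_integral_gaussian_coeff {a : ℕ → ℂ} {f : ℂ → ℂ}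
    (h : IsDirichletSeriesOf a f) {δ : ℝ} (hδ : 0 < δ) (x : ℝ) :
    Tendsto (fun v : ℕ => ∫ t : ℝ, f ((δ : ℂ) + t * Complex.I) * Complex.exp (x * t * Complex.I)
        ∂(gaussianReal 0 (v : NNReal))) atTop
      (𝓝 (∑' n : ℕ, if x = Real.log (n + 1 : ℕ) then
        a (n + 1) * (((n + 1 : ℕ) : ℝ) ^ (-δ) : ℝ) else 0)) := by
  -- Each term is a difference of two consecutive partial sums at δ.
  obtain ⟨C, hC⟩ : ∃ C, ∀ n : ℕ, ‖a (n + 1) * (((n + 1 : ℕ) : ℝ) ^ (-δ) : ℝ)‖ ≤ C := by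
    obtain ⟨C, hC⟩ := exists_norm_le_of_tendsto
      (h.tendsto_range (s := (δ : ℂ)) (by simpa using hδ))
    refine ⟨C + C, fun n => ?_⟩
    have := (norm_sub_le _ _).trans (add_le_add (hC (n + 1)) (hC n))
    rw [Finset.sum_range_succ, add_sub_cancel_left] at this
    rwa [Complex.ofReal_cpow (by positivity), Complex.ofReal_neg]
  set F : ℕ → ℕ → ℂ := fun v n => a (n + 1) * (((n + 1 : ℕ) : ℝ) ^ (-δ) : ℝ) *
        ((Real.exp (-(v * (x - Real.log (n + 1 : ℕ)) ^ 2 / 2)) : ℝ) : ℂ) with hF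
  set bd : ℕ → ℝ := fun n => C * (Real.exp (2 * x + 2) * ((n + 1 : ℕ) : ℝ) ^ (-2 : ℝ)) with hbd
  have hbs : Summable bd := by
    refine Summable.mul_left _ (Summable.mul_left _ ?_)
    exact (summable_nat_add_iff 1).mpr (Real.summable_nat_rpow.mpr (by norm_num))
  have hle : ∀ v : ℕ, 1 ≤ v → ∀ n, ‖F v n‖ ≤ bd n := by
    intro v hv n
    rw [hF, hbd]
    simp only
    rw [norm_mul]
    refine mul_le_mul (hC n) ?_ (norm_nonneg _) ((norm_nonneg _).trans (hC n))
    rw [Complex.norm_real, Real.norm_of_nonneg (Real.exp_pos _).le]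
    refine le_trans ?_ (exp_neg_sq_sub_log_le x (Nat.succ_pos n))
    apply Real.exp_le_exp.mpr
    have : (1 : ℝ) ≤ v := by exact_mod_cast hv
    nlinarith [sq_nonneg (x - Real.log (n + 1 : ℕ))]
  have hI : ∀ v : ℕ, 1 ≤ v → ∫ t : ℝ, f ((δ : ℂ) + t * Complex.I) *
      Complex.exp (x * t * Complex.I) ∂(gaussianReal 0 (v : NNReal)) = ∑' n, F v n := by
    intro v hv
    have hs : Summable (F v) := Summable.of_norm_bounded hbs (hle v hv)
    refine tendsto_nhds_unique (h.tendsto_integral_gaussian hδ v x) ?_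
    simpa [hF] using hs.hasSum.tendsto_sum_nat
  have hlim : Tendsto (fun v => ∑' n, F v n) atTop (𝓝 (∑' n : ℕ, if x = Real.log (n + 1 : ℕ) then
        a (n + 1) * (((n + 1 : ℕ) : ℝ) ^ (-δ) : ℝ) else 0)) := by
    refine tendsto_tsum_of_dominated_convergence hbs (fun n => ?_)
      (eventually_atTop.mpr ⟨1, hle⟩)
    split_ifs with hx
    · simp only [hF, ← hx]; simp
    · have h0 : 0 < (x - Real.log (n + 1 : ℕ)) ^ 2 := by
        have := sub_ne_zero.mpr hx; positivity
      have h1 : Tendsto (fun v : ℕ => Real.exp (-(v * (x - Real.log (n + 1 : ℕ)) ^ 2 / 2)))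
          atTop (𝓝 0) := by
        refine Real.tendsto_exp_atBot.comp (tendsto_neg_atTop_atBot.comp ?_)
        exact (tendsto_natCast_atTop_atTop.atTop_mul_const h0).atTop_div_const (by norm_num)
      have h2 := ((Complex.continuous_ofReal.tendsto 0).comp h1).const_mul
        (a (n + 1) * ((((n + 1 : ℕ) : ℝ) ^ (-δ) : ℝ) : ℂ))
      simpa [hF, Function.comp_def] using h2
  exact hlim.congr' (eventually_atTop.mpr ⟨1, fun v hv => (hI v hv).symm⟩)

lemma norm_cexp_mul_mul_I (x t : ℝ) : ‖Complex.exp (x * t * Complex.I)‖ = 1 := by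
  rw [← Complex.ofReal_mul, Complex.norm_exp_ofReal_mul_I]

lemma sub_log_eq_log_iff {m l n : ℕ} (hm : 0 < m) (hl : 0 < l) (hn : 0 < n) :
    Real.log l - Real.log m = Real.log n ↔ l = m * n := by
  have hm' : (0 : ℝ) < m := by exact_mod_cast hm
  have hl' : (0 : ℝ) < l := by exact_mod_cast hl
  have hn' : (0 : ℝ) < n := by exact_mod_cast hn
  rw [sub_eq_iff_eq_add', ← Real.log_mul hm'.ne' hn'.ne']
  refine ⟨fun h => ?_, fun h => by rw [h]; push_cast; rfl⟩
  have := Real.log_injOn_pos (Set.mem_Ioi.mpr hl') (Set.mem_Ioi.mpr (mul_pos hm' hn')) h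
  exact_mod_cast this

/-- By unique frequencies, the character of frequency log l - log m picks out a_{l/m}: these are the
matrix entries of multiplication by f in the basis n^{-s}. -/
lemma tsum_ite_sub_log_eq (c : ℕ → ℂ) {m l : ℕ} (hm : 0 < m) (hl : 0 < l) :
    (∑' n : ℕ, if Real.log l - Real.log m = Real.log (n + 1 : ℕ) then c (n + 1) else 0)
      = if m ∣ l then c (l / m) else 0 := by
  simp_rw [sub_log_eq_log_iff hm hl (Nat.succ_pos _)]
  split_ifs with h
  · obtain ⟨k, rfl⟩ := h
    have hk : 0 < k := Nat.pos_of_mul_pos_left hl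
    obtain ⟨j, rfl⟩ := Nat.exists_eq_succ_of_ne_zero hk.ne'
    rw [tsum_eq_single j]
    · simp [Nat.mul_div_cancel_left _ hm]
    · intro b hb
      rw [if_neg]
      intro h
      have := Nat.eq_of_mul_eq_mul_left hm h
      omega
  · rw [tsum_congr (g := fun _ => 0), tsum_zero]
    intro n
    rw [if_neg]
    rintro rfl
    exact h (dvd_mul_right _ _)

/-! ### Asymptotic orthogonality and the contraction property -/

lemma tendsto_exp_neg_natCast_mul (y : ℝ) :
    Tendsto (fun v : ℕ => Real.exp (-(v * y ^ 2 / 2))) atTop (𝓝 (if y = 0 then 1 else 0)) := by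
  split_ifs with hy
  · simp [hy]
  · have h0 : 0 < y ^ 2 := by positivity
    refine Real.tendsto_exp_atBot.comp (tendsto_neg_atTop_atBot.comp ?_)
    exact (tendsto_natCast_atTop_atTop.atTop_mul_const h0).atTop_div_const (by norm_num)

lemma integrable_of_continuous_of_norm_le {F : ℝ → ℂ} (hF : Continuous F) {C : ℝ} (hC : ∀ t, ‖F t‖ ≤ C)
    (μ : Measure ℝ) [IsFiniteMeasure μ] : Integrable F μ :=
  Integrable.of_bound (C := C) hF.aestronglyMeasurable (ae_of_all _ hC)

/-- The Dirichlet polynomial `∑ g m * m ^ (-it)`. -/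
noncomputable def dirichletPoly (S : Finset ℕ) (g : ℕ → ℂ) (t : ℝ) : ℂ :=
  ∑ m ∈ S, g m * Complex.exp ((-Real.log m : ℝ) * t * Complex.I)

lemma continuous_dirichletPoly (S : Finset ℕ) (g : ℕ → ℂ) : Continuous (dirichletPoly S g) := by
  unfold dirichletPoly; fun_prop

lemma norm_dirichletPoly_le (S : Finset ℕ) (g : ℕ → ℂ) (t : ℝ) :
    ‖dirichletPoly S g t‖ ≤ ∑ m ∈ S, ‖g m‖ := by
  refine (norm_sum_le _ _).trans (Finset.sum_le_sum fun m _ => ?_)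
  rw [norm_mul, norm_cexp_mul_mul_I, mul_one]

lemma dirichletPoly_mul_conj (S : Finset ℕ) (g v : ℕ → ℂ) (t : ℝ) :
    dirichletPoly S g t * conj (dirichletPoly S v t) = ∑ m ∈ S, ∑ l ∈ S, g m * conj (v l) *
      Complex.exp ((Real.log l - Real.log m : ℝ) * t * Complex.I) := by
  unfold dirichletPoly
  rw [map_sum, Finset.sum_mul_sum]
  refine Finset.sum_congr rfl fun m _ => Finset.sum_congr rfl fun l _ => ?_
  rw [map_mul, ← Complex.exp_conj, mul_mul_mul_comm, ← Complex.exp_add]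
  congr 2
  simp only [map_mul, Complex.conj_ofReal, Complex.conj_I]
  push_cast
  ring

/-- The cross terms have nonzero frequency log l - log m, and their Gaussian means vanish in the
limit. -/
lemma tendsto_integral_norm_sq_dirichletPoly {S : Finset ℕ} (hS : ∀ n ∈ S, 0 < n) (g : ℕ → ℂ) :
    Tendsto (fun v : ℕ => ∫ t, ‖dirichletPoly S g t‖ ^ 2 ∂(gaussianReal 0 (v : NNReal))) atTop
      (𝓝 (∑ m ∈ S, ‖g m‖ ^ 2)) := by
  have key : ∀ v : ℕ, ((∫ t, ‖dirichletPoly S g t‖ ^ 2 ∂(gaussianReal 0 (v : NNReal)) : ℝ) : ℂ)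
      = ∑ m ∈ S, ∑ l ∈ S, g m * conj (g l) *
        ((Real.exp (-(v * (Real.log l - Real.log m) ^ 2 / 2)) : ℝ) : ℂ) := by
    intro v
    rw [← integral_complex_ofReal]
    simp_rw [Complex.ofReal_pow, ← Complex.mul_conj', dirichletPoly_mul_conj]
    have hi : ∀ m l : ℕ, Integrable (fun t : ℝ => g m * conj (g l) *
      Complex.exp ((Real.log l - Real.log m : ℝ) * t * Complex.I))
        (gaussianReal 0 (v : NNReal)) := fun m l => by
      refine integrable_of_continuous_of_norm_le (by fun_prop) (C := ‖g m * conj (g l)‖) (fun t => ?_) _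
      rw [norm_mul _ (Complex.exp _), norm_cexp_mul_mul_I, mul_one]
    rw [integral_finsetSum _ fun m _ => integrable_finsetSum _ fun l _ => hi m l]
    refine Finset.sum_congr rfl fun m _ => ?_
    rw [integral_finsetSum _ fun l _ => hi m l]
    refine Finset.sum_congr rfl fun l _ => ?_
    rw [integral_const_mul, integral_cexp_mul_I_gaussianReal]
    simp
  have hlim : Tendsto (fun v : ℕ => ∑ m ∈ S, ∑ l ∈ S, g m * conj (g l) *
        ((Real.exp (-(v * (Real.log l - Real.log m) ^ 2 / 2)) : ℝ) : ℂ)) atTop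
      (𝓝 (∑ m ∈ S, ∑ l ∈ S, g m * conj (g l) *
        (((if Real.log l - Real.log m = 0 then 1 else 0 : ℝ)) : ℂ))) :=
    tendsto_finsetSum _ fun m _ => tendsto_finsetSum _ fun l _ =>
      ((Complex.continuous_ofReal.tendsto _).comp (tendsto_exp_neg_natCast_mul _)).const_mul _
  have hval : ∑ m ∈ S, ∑ l ∈ S, g m * conj (g l) *
        (((if Real.log l - Real.log m = 0 then 1 else 0 : ℝ)) : ℂ)
      = ((∑ m ∈ S, ‖g m‖ ^ 2 : ℝ) : ℂ) := by
    rw [Complex.ofReal_sum]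
    refine Finset.sum_congr rfl fun m hm => ?_
    rw [Finset.sum_eq_single_of_mem m hm]
    · simp [Complex.mul_conj']
    · intro l hl hlm
      rw [if_neg]
      · simp
      · rw [← Real.log_one, ← Nat.cast_one, sub_log_eq_log_iff (hS m hm) (hS l hl) one_pos]
        simpa using hlm
  rw [hval] at hlim
  simp_rw [← key] at hlim
  exact (Complex.continuous_re.tendsto _).comp hlim

/-- Multiplication by a Dirichlet series of sup norm at most `1` is a contraction in `ℓ²`. -/
lemma IsDirichletSeriesOf.norm_sum_dvd_le {a : ℕ → ℂ} {f : ℂ → ℂ} (h : IsDirichletSeriesOf a f)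
    (hc : ContinuousOn f rightHalfPlane) (hb : ∀ s ∈ rightHalfPlane, ‖f s‖ ≤ 1)
    {S : Finset ℕ} (hS : ∀ n ∈ S, 0 < n) (g v : ℕ → ℂ) :
    ‖∑ m ∈ S, ∑ l ∈ S, g m * conj (v l) * (if m ∣ l then a (l / m) else 0)‖
      ≤ (∑ m ∈ S, ‖g m‖ ^ 2 + ∑ m ∈ S, ‖v m‖ ^ 2) / 2 := by
  -- The means are taken on Re s = δ, where a_n is replaced by a_n n^{-δ}; the form is a finite sum,
  -- so δ → 0 is harmless.
  have main : ∀ δ : ℝ, 0 < δ → ‖∑ m ∈ S, ∑ l ∈ S, g m * conj (v l) *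
      (if m ∣ l then a (l / m) * (((l / m : ℕ) : ℝ) ^ (-δ) : ℝ) else 0)‖
      ≤ (∑ m ∈ S, ‖g m‖ ^ 2 + ∑ m ∈ S, ‖v m‖ ^ 2) / 2 := by
    intro δ hδ
    have hmem : ∀ t : ℝ, (δ : ℂ) + t * Complex.I ∈ rightHalfPlane := fun t => by
      simpa [rightHalfPlane] using hδ
    have hfc : Continuous fun t : ℝ => f ((δ : ℂ) + t * Complex.I) :=
      hc.comp_continuous (by fun_prop) hmem
    have hL : Tendsto (fun k : ℕ => ∑ m ∈ S, ∑ l ∈ S, g m * conj (v l) *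
        ∫ t : ℝ, f ((δ : ℂ) + t * Complex.I) *
          Complex.exp ((Real.log l - Real.log m : ℝ) * t * Complex.I)
          ∂(gaussianReal 0 (k : NNReal))) atTop
        (𝓝 (∑ m ∈ S, ∑ l ∈ S, g m * conj (v l) *
          (if m ∣ l then a (l / m) * (((l / m : ℕ) : ℝ) ^ (-δ) : ℝ) else 0))) := by
      refine tendsto_finsetSum _ fun m hm => tendsto_finsetSum _ fun l hl => ?_
      rw [← tsum_ite_sub_log_eq (fun n => a n * (((n : ℝ) ^ (-δ) : ℝ) : ℂ)) (hS m hm) (hS l hl)]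
      exact (h.tendsto_integral_gaussian_coeff hδ _).const_mul _
    have hR := ((tendsto_integral_norm_sq_dirichletPoly hS g).add
      (tendsto_integral_norm_sq_dirichletPoly hS v)).div_const 2
    refine le_of_tendsto_of_tendsto' hL.norm hR fun k => ?_
    set ν := gaussianReal 0 (k : NNReal)
    have hi : ∀ m l : ℕ, Integrable (fun t : ℝ => g m * conj (v l) *
      (f ((δ : ℂ) + t * Complex.I) *
        Complex.exp ((Real.log l - Real.log m : ℝ) * t * Complex.I))) ν := fun m l => by
      refine (integrable_of_continuous_of_norm_le (hfc.mul (by fun_prop)) (C := 1) (fun t => ?_) _).const_mul _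
      rw [Pi.mul_apply, norm_mul, norm_cexp_mul_mul_I, mul_one]
      exact hb _ (hmem t)
    have hsq : ∀ u : ℕ → ℂ, Integrable (fun t => ‖dirichletPoly S u t‖ ^ 2) ν := fun u => by
      refine Integrable.of_bound (C := (∑ m ∈ S, ‖u m‖) ^ 2)
        ((continuous_dirichletPoly S u).norm.pow 2).aestronglyMeasurable (ae_of_all _ fun t => ?_)
      rw [norm_pow, norm_norm]
      gcongr
      exact norm_dirichletPoly_le S u t
    have e : ∑ m ∈ S, ∑ l ∈ S, g m * conj (v l) *
        ∫ t : ℝ, f ((δ : ℂ) + t * Complex.I) *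
          Complex.exp ((Real.log l - Real.log m : ℝ) * t * Complex.I) ∂ν
        = ∫ t : ℝ, f ((δ : ℂ) + t * Complex.I) *
          (dirichletPoly S g t * conj (dirichletPoly S v t)) ∂ν := by
      simp_rw [dirichletPoly_mul_conj, Finset.mul_sum, mul_left_comm (f _)]
      rw [integral_finsetSum _ fun m _ => integrable_finsetSum _ fun l _ => hi m l]
      refine Finset.sum_congr rfl fun m _ => ?_
      rw [integral_finsetSum _ fun l _ => hi m l]
      refine Finset.sum_congr rfl fun l _ => ?_
      rw [integral_const_mul]
    rw [e, ← integral_add (hsq g) (hsq v), ← integral_div]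
    -- The bound is |f g v̄| ≤ |g||v| ≤ (|g|² + |v|²)/2 pointwise.
    refine norm_integral_le_of_norm_le (((hsq g).add (hsq v)).div_const 2) (ae_of_all _ fun t => ?_)
    rw [norm_mul, norm_mul, RCLike.norm_conj]
    have h1 := hb _ (hmem t)
    have h2 : 0 ≤ ‖dirichletPoly S g t‖ * ‖dirichletPoly S v t‖ := by positivity
    nlinarith [sq_nonneg (‖dirichletPoly S g t‖ - ‖dirichletPoly S v t‖),
      mul_le_mul_of_nonneg_right h1 h2]
  have hlim : Tendsto (fun δ : ℝ => ∑ m ∈ S, ∑ l ∈ S, g m * conj (v l) *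
      (if m ∣ l then a (l / m) * (((l / m : ℕ) : ℝ) ^ (-δ) : ℝ) else 0)) (𝓝[>] 0)
      (𝓝 (∑ m ∈ S, ∑ l ∈ S, g m * conj (v l) * (if m ∣ l then a (l / m) else 0))) := by
    refine tendsto_finsetSum _ fun m hm => tendsto_finsetSum _ fun l hl => ?_
    refine Tendsto.const_mul _ ?_
    split_ifs with hd
    · have hq : (0 : ℝ) < ((l / m : ℕ) : ℝ) := by
        exact_mod_cast Nat.div_pos (Nat.le_of_dvd (hS l hl) hd) (hS m hm)
      have : Continuous fun δ : ℝ => a (l / m) * ((((l / m : ℕ) : ℝ) ^ (-δ) : ℝ) : ℂ) := by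
        refine continuous_const.mul (Complex.continuous_ofReal.comp ?_)
        exact Real.continuous_const_rpow hq.ne' |>.comp continuous_neg
      have h2 := this.tendsto 0
      simp only [neg_zero, Real.rpow_zero, Complex.ofReal_one, mul_one] at h2
      exact h2.mono_left nhdsWithin_le_nhds
    · exact tendsto_const_nhds
  exact le_of_tendsto hlim.norm (eventually_mem_nhdsWithin.mono fun δ hδ => main δ hδ)

/-! ### The grading by Ω and the norms of the blocks -/

/-- A proper divisor has strictly smaller Ω. Hence convolution is block triangular for the grading,
with scalar diagonal blocks. -/
lemma eq_of_dvd_of_cardFactors_le {m l : ℕ} (hl : l ≠ 0) (h : m ∣ l)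
    (hΩ : Ω l ≤ Ω m) : m = l := by
  obtain ⟨k, rfl⟩ := h
  have hm : m ≠ 0 := left_ne_zero_of_mul hl
  have hk : k ≠ 0 := right_ne_zero_of_mul hl
  rw [ArithmeticFunction.cardFactors_mul hm hk] at hΩ
  have : Ω k = 0 := by omega
  rw [ArithmeticFunction.cardFactors_eq_zero_iff_eq_zero_or_one] at this
  rcases this with h | h
  · exact absurd h hk
  · rw [h, mul_one]

/-- The sequence `a` acts on `ℓ²` by Dirichlet convolution as a contraction. -/
def IsConvContraction (a : ℕ → ℂ) : Prop :=
  ∀ S : Finset ℕ, (∀ n ∈ S, 0 < n) → ∀ g v : ℕ → ℂ,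
    ‖∑ m ∈ S, ∑ l ∈ S, g m * conj (v l) * (if m ∣ l then a (l / m) else 0)‖
      ≤ (∑ m ∈ S, ‖g m‖ ^ 2 + ∑ m ∈ S, ‖v m‖ ^ 2) / 2

lemma isConvContraction_of_hInftyNorm_eq_one {a : ℕ → ℂ} {f : ℂ → ℂ} (hf : MemHInfty f)
    (ha : IsDirichletSeriesOf a f) (h1 : hInftyNorm f = 1) : IsConvContraction a :=
  fun _ hS g v => ha.norm_sum_dvd_le hf.holomorphic.continuousOn
    (fun s hs => h1 ▸ le_csSup hf.bounded ⟨s, hs, rfl⟩) hS g v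

namespace IsConvContraction

variable {a : ℕ → ℂ}

/-- Contractivity restricted to two levels of the grading by `Ω`. -/
lemma re_sum_le (ha : IsConvContraction a) {j k : ℕ} (hjk : j < k) {U W : Finset ℕ}
    (hU : ∀ n ∈ U, n ≠ 0 ∧ Ω n = j) (hW : ∀ n ∈ W, n ≠ 0 ∧ Ω n = k) (u w : ℕ → ℂ) :
    (∑ m ∈ U, ∑ l ∈ W, u m * conj (w l) * (if m ∣ l then a (l / m) else 0)).re
      ≤ (1 - ‖a 1‖ ^ 2) / 2 * (∑ m ∈ U, ‖u m‖ ^ 2 + ∑ l ∈ W, ‖w l‖ ^ 2) := by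
  have hd : Disjoint U W := Finset.disjoint_left.mpr fun n hn hn' => by
    have := (hU n hn).2; have := (hW n hn').2; omega
  have hS : ∀ n ∈ U ∪ W, 0 < n := fun n hn => by
    rcases Finset.mem_union.mp hn with h | h
    · exact Nat.pos_of_ne_zero (hU n h).1
    · exact Nat.pos_of_ne_zero (hW n h).1
  -- The test vectors are (u, ā₁w) and (a₁u, w). The two diagonal blocks contribute |a₁|²(‖u‖² +
  -- ‖w‖²), while contractivity allows (1 + |a₁|²)/2 times the same quantity; the difference is left
  -- for the off-diagonal block.
  set g : ℕ → ℂ := fun n => if n ∈ U then u n else conj (a 1) * w n with hg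
  set v : ℕ → ℂ := fun n => if n ∈ U then a 1 * u n else w n with hv
  have hWU : ∀ {n}, n ∈ W → n ∉ U := fun hn hn' => Finset.disjoint_left.mp hd hn' hn
  have gU : ∀ n ∈ U, g n = u n := fun n hn => if_pos hn
  have gW : ∀ n ∈ W, g n = conj (a 1) * w n := fun n hn => if_neg (hWU hn)
  have vU : ∀ n ∈ U, v n = a 1 * u n := fun n hn => if_pos hn
  have vW : ∀ n ∈ W, v n = w n := fun n hn => if_neg (hWU hn)
  have diag : ∀ (i : ℕ) (V : Finset ℕ), (∀ n ∈ V, n ≠ 0 ∧ Ω n = i) → ∀ m ∈ V,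
      ∑ l ∈ V, g m * conj (v l) * (if m ∣ l then a (l / m) else 0)
        = g m * conj (v m) * a 1 := by
    intro i V hV m hm
    rw [Finset.sum_eq_single_of_mem m hm]
    · rw [if_pos dvd_rfl, Nat.div_self (Nat.pos_of_ne_zero (hV m hm).1)]
    · intro l hl hlm
      rw [if_neg, mul_zero]
      intro hdvd
      exact hlm (eq_of_dvd_of_cardFactors_le (hV l hl).1 hdvd
        (by rw [(hV l hl).2, (hV m hm).2])).symm
  have off : ∀ m ∈ W, ∑ l ∈ U, g m * conj (v l) * (if m ∣ l then a (l / m) else 0) = 0 := by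
    intro m hm
    refine Finset.sum_eq_zero fun l hl => ?_
    rw [if_neg, mul_zero]
    intro hdvd
    have h1 := eq_of_dvd_of_cardFactors_le (hU l hl).1 hdvd
      (by rw [(hU l hl).2, (hW m hm).2]; exact hjk.le)
    subst h1
    exact hWU hm hl
  have main := ha (U ∪ W) hS g v
  have e1 : ∑ m ∈ U ∪ W, ∑ l ∈ U ∪ W, g m * conj (v l) * (if m ∣ l then a (l / m) else 0)
      = ((‖a 1‖ ^ 2 * (∑ m ∈ U, ‖u m‖ ^ 2 + ∑ l ∈ W, ‖w l‖ ^ 2) : ℝ) : ℂ)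
        + ∑ m ∈ U, ∑ l ∈ W, u m * conj (w l) * (if m ∣ l then a (l / m) else 0) := by
    rw [Finset.sum_union hd]
    simp_rw [Finset.sum_union hd]
    rw [Finset.sum_add_distrib, Finset.sum_add_distrib, Finset.sum_congr rfl (diag j U hU),
      Finset.sum_congr rfl (diag k W hW), Finset.sum_congr rfl off]
    have t1 : ∑ m ∈ U, g m * conj (v m) * a 1 = ((‖a 1‖ ^ 2 * ∑ m ∈ U, ‖u m‖ ^ 2 : ℝ) : ℂ) := by
      push_cast
      rw [Finset.mul_sum]
      refine Finset.sum_congr rfl fun m hm => ?_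
      rw [gU m hm, vU m hm, map_mul, ← Complex.mul_conj', ← Complex.mul_conj']
      ring
    have t2 : ∑ m ∈ W, g m * conj (v m) * a 1 = ((‖a 1‖ ^ 2 * ∑ m ∈ W, ‖w m‖ ^ 2 : ℝ) : ℂ) := by
      push_cast
      rw [Finset.mul_sum]
      refine Finset.sum_congr rfl fun m hm => ?_
      rw [gW m hm, vW m hm, ← Complex.mul_conj', ← Complex.mul_conj']
      ring
    have t3 : ∑ m ∈ U, ∑ l ∈ W, g m * conj (v l) * (if m ∣ l then a (l / m) else 0)
        = ∑ m ∈ U, ∑ l ∈ W, u m * conj (w l) * (if m ∣ l then a (l / m) else 0) :=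
      Finset.sum_congr rfl fun m hm => Finset.sum_congr rfl fun l hl => by
        rw [gU m hm, vW l hl]
    rw [t1, t2, t3, Finset.sum_const_zero]
    push_cast
    ring
  have e2 : ∑ m ∈ U ∪ W, ‖g m‖ ^ 2 = ∑ m ∈ U, ‖u m‖ ^ 2 + ‖a 1‖ ^ 2 * ∑ l ∈ W, ‖w l‖ ^ 2 := by
    rw [Finset.sum_union hd, Finset.mul_sum, Finset.sum_congr rfl fun m hm => by rw [gU m hm],
      Finset.sum_congr (s₁ := W) rfl fun m hm => by
        rw [gW m hm, norm_mul, RCLike.norm_conj, mul_pow]]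
  have e3 : ∑ m ∈ U ∪ W, ‖v m‖ ^ 2 = ‖a 1‖ ^ 2 * ∑ m ∈ U, ‖u m‖ ^ 2 + ∑ l ∈ W, ‖w l‖ ^ 2 := by
    rw [Finset.sum_union hd, Finset.mul_sum, Finset.sum_congr (s₁ := W) rfl fun m hm => by
      rw [vW m hm], Finset.sum_congr rfl fun m hm => by rw [vU m hm, norm_mul, mul_pow]]
  rw [e2, e3] at main
  have := (Complex.re_le_norm _).trans main
  rw [e1, Complex.add_re, Complex.ofReal_re] at this
  nlinarith

lemma norm_one_le (ha : IsConvContraction a) : ‖a 1‖ ≤ 1 := by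
  have := ha {1} (by simp) (fun _ => 1) (fun _ => 1)
  simpa using this

lemma one_sub_sq_nonneg (ha : IsConvContraction a) : 0 ≤ 1 - ‖a 1‖ ^ 2 := by
  nlinarith [ha.norm_one_le, norm_nonneg (a 1)]

/-- Convolution by `a` between the levels `j < k` of the grading by `Ω` has norm at most
`1 - |a₁|²`. -/
lemma sum_norm_sq_sum_le (ha : IsConvContraction a) {j k : ℕ} (hjk : j < k) {U W : Finset ℕ}
    (hU : ∀ n ∈ U, n ≠ 0 ∧ Ω n = j) (hW : ∀ n ∈ W, n ≠ 0 ∧ Ω n = k) (u : ℕ → ℂ) :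
    ∑ l ∈ W, ‖∑ m ∈ U, u m * (if m ∣ l then a (l / m) else 0)‖ ^ 2
      ≤ (1 - ‖a 1‖ ^ 2) ^ 2 * ∑ m ∈ U, ‖u m‖ ^ 2 := by
  set V : ℕ → ℂ := fun l => ∑ m ∈ U, u m * (if m ∣ l then a (l / m) else 0) with hV
  change ∑ l ∈ W, ‖V l‖ ^ 2 ≤ _
  set c := ∑ l ∈ W, ‖V l‖ ^ 2 with hc
  have hD := ha.one_sub_sq_nonneg
  set D := 1 - ‖a 1‖ ^ 2 with hDdef
  set b := ∑ m ∈ U, ‖u m‖ ^ 2 with hb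
  -- Testing against a multiple r of the image vector itself; the optimal r is 1/D, and any positive
  -- r does when D = 0.
  have key : ∀ r : ℝ, r * c ≤ D / 2 * (b + r ^ 2 * c) := by
    intro r
    have h := ha.re_sum_le hjk hU hW u (fun n => r * V n)
    have e1 : ∑ m ∈ U, ∑ l ∈ W, u m * conj (r * V l) * (if m ∣ l then a (l / m) else 0)
        = ((r * c : ℝ) : ℂ) := by
      rw [Finset.sum_comm, hc]
      push_cast
      rw [Finset.mul_sum]
      refine Finset.sum_congr rfl fun l _ => ?_
      rw [← Complex.mul_conj', map_mul, Complex.conj_ofReal]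
      conv_rhs => rw [hV]
      rw [Finset.sum_mul, Finset.mul_sum]
      refine Finset.sum_congr rfl fun m _ => ?_
      ring
    rw [e1, Complex.ofReal_re] at h
    have e2 : ∑ n ∈ W, ‖(r : ℂ) * V n‖ ^ 2 = r ^ 2 * c := by
      rw [hc, Finset.mul_sum]
      refine Finset.sum_congr rfl fun l _ => ?_
      rw [norm_mul, mul_pow, Complex.norm_real, Real.norm_eq_abs, sq_abs]
    rwa [e2] at h
  rcases hD.eq_or_lt with h0 | h0
  · have := key 1
    rw [← h0] at this ⊢
    linarith
  · have := key (1 / D)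
    have e : 1 / D * c = c / D := by ring
    have e' : D / 2 * (b + (1 / D) ^ 2 * c) = D * b / 2 + c / D / 2 := by field_simp
    rw [e, e'] at this
    have : c / D ≤ D * b := by linarith
    rw [div_le_iff₀ h0] at this
    linarith

/-- The `ℓ²` norm of a homogeneous block is at most `1 - |a₁|²`. -/
lemma sum_norm_sq_le (ha : IsConvContraction a) {k : ℕ} (hk : 0 < k) {W : Finset ℕ}
    (hW : ∀ n ∈ W, n ≠ 0 ∧ Ω n = k) : ∑ n ∈ W, ‖a n‖ ^ 2 ≤ (1 - ‖a 1‖ ^ 2) ^ 2 := by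
  -- Convolving the unit vector at 1 with a gives a back.
  simpa using ha.sum_norm_sq_sum_le hk (U := {1}) (by simp) hW (fun _ => 1)

/-- Restricting convolution by `a` to the span of the indices `2` and `3`. -/
lemma two_three_block_le (ha : IsConvContraction a) {Q : Finset ℕ}
    (hQ : ∀ p ∈ Q, p.Prime ∧ p ≠ 2 ∧ p ≠ 3) :
    ‖a 2‖ ^ 4 + 4 * ‖a 2‖ ^ 2 * ‖a 3‖ ^ 2 + ‖a 3‖ ^ 4
        + (‖a 2‖ ^ 2 + ‖a 3‖ ^ 2) * ∑ p ∈ Q, ‖a p‖ ^ 2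
      ≤ (1 - ‖a 1‖ ^ 2) ^ 2 * (‖a 2‖ ^ 2 + ‖a 3‖ ^ 2) := by
  have hΩ : ∀ {p q : ℕ}, p.Prime → q.Prime → p * q ≠ 0 ∧ Ω (p * q) = 2 := fun hp hq => by
    refine ⟨mul_ne_zero hp.ne_zero hq.ne_zero, ?_⟩
    rw [ArithmeticFunction.cardFactors_mul hp.ne_zero hq.ne_zero,
      ArithmeticFunction.cardFactors_apply_prime hp, ArithmeticFunction.cardFactors_apply_prime hq]
  have h2 : ∀ p ∈ Q, ¬ 2 ∣ p := fun p hp h =>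
    (hQ p hp).2.1 ((Nat.prime_dvd_prime_iff_eq Nat.prime_two (hQ p hp).1).mp h).symm
  have h3 : ∀ p ∈ Q, ¬ 3 ∣ p := fun p hp h =>
    (hQ p hp).2.2 ((Nat.prime_dvd_prime_iff_eq Nat.prime_three (hQ p hp).1).mp h).symm
  set W₂ := Q.image (2 * ·) with hW₂
  set W₃ := Q.image (3 * ·) with hW₃
  set T : Finset ℕ := {4, 6, 9} with hT
  have d23 : Disjoint W₂ W₃ := by
    rw [Finset.disjoint_left]
    rintro n hn hn'
    obtain ⟨p, hp, rfl⟩ := Finset.mem_image.mp hn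
    obtain ⟨q, hq, hpq⟩ := Finset.mem_image.mp hn'
    have := h2 q hq
    omega
  have dT : Disjoint T (W₂ ∪ W₃) := by
    rw [Finset.disjoint_left]
    intro n hn hn'
    rw [Finset.mem_union, Finset.mem_image, Finset.mem_image] at hn'
    rw [hT] at hn
    simp only [Finset.mem_insert, Finset.mem_singleton] at hn
    rcases hn' with ⟨p, hp, h⟩ | ⟨p, hp, h⟩
    · have := h2 p hp; have := h3 p hp; omega
    · have := h2 p hp; have := h3 p hp; omega
  -- The input is a itself on {2, 3}. Its image is a₂², 2a₂a₃, a₃² at 4, 6, 9 and a₂a_p, a₃a_p at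
  -- 2p, 3p; the doubled entry at 6 is the source of the gain.
  have main := ha.sum_norm_sq_sum_le (j := 1) (k := 2) one_lt_two (U := {2, 3})
    (W := T ∪ (W₂ ∪ W₃))
    (by
      intro n hn
      simp only [Finset.mem_insert, Finset.mem_singleton] at hn
      rcases hn with rfl | rfl
      · exact ⟨by norm_num, ArithmeticFunction.cardFactors_apply_prime Nat.prime_two⟩
      · exact ⟨by norm_num, ArithmeticFunction.cardFactors_apply_prime Nat.prime_three⟩)
    (by
      intro n hn
      rw [Finset.mem_union, Finset.mem_union, Finset.mem_image, Finset.mem_image, hT] at hn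
      simp only [Finset.mem_insert, Finset.mem_singleton] at hn
      rcases hn with (rfl | rfl | rfl) | ⟨p, hp, rfl⟩ | ⟨p, hp, rfl⟩
      · exact hΩ Nat.prime_two Nat.prime_two
      · exact hΩ Nat.prime_two Nat.prime_three
      · exact hΩ Nat.prime_three Nat.prime_three
      · exact hΩ Nat.prime_two (hQ p hp).1
      · exact hΩ Nat.prime_three (hQ p hp).1) a
  have hsum : ∀ F : ℕ → ℂ, ∑ m ∈ ({2, 3} : Finset ℕ), F m = F 2 + F 3 := fun F =>
    Finset.sum_pair (by norm_num)
  simp_rw [hsum] at main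
  rw [Finset.sum_pair (by norm_num), Finset.sum_union dT, Finset.sum_union d23,
    Finset.sum_image (fun _ _ _ _ h => by simpa using h),
    Finset.sum_image (fun _ _ _ _ h => by simpa using h)] at main
  have e2 : ∑ p ∈ Q, ‖a 2 * (if 2 ∣ 2 * p then a (2 * p / 2) else 0)
      + a 3 * (if 3 ∣ 2 * p then a (2 * p / 3) else 0)‖ ^ 2 = ‖a 2‖ ^ 2 * ∑ p ∈ Q, ‖a p‖ ^ 2 := by
    rw [Finset.mul_sum]
    refine Finset.sum_congr rfl fun p hp => ?_
    have := h3 p hp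
    rw [if_pos (dvd_mul_right _ _), if_neg (by omega), Nat.mul_div_cancel_left _ two_pos,
      mul_zero, add_zero, norm_mul, mul_pow]
  have e3 : ∑ p ∈ Q, ‖a 2 * (if 2 ∣ 3 * p then a (3 * p / 2) else 0)
      + a 3 * (if 3 ∣ 3 * p then a (3 * p / 3) else 0)‖ ^ 2 = ‖a 3‖ ^ 2 * ∑ p ∈ Q, ‖a p‖ ^ 2 := by
    rw [Finset.mul_sum]
    refine Finset.sum_congr rfl fun p hp => ?_
    have := h2 p hp
    rw [if_neg (by omega), if_pos (dvd_mul_right _ _), Nat.mul_div_cancel_left _ three_pos,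
      mul_zero, zero_add, norm_mul, mul_pow]
  have eT : ∑ l ∈ T, ‖a 2 * (if 2 ∣ l then a (l / 2) else 0)
      + a 3 * (if 3 ∣ l then a (l / 3) else 0)‖ ^ 2
      = ‖a 2‖ ^ 4 + 4 * ‖a 2‖ ^ 2 * ‖a 3‖ ^ 2 + ‖a 3‖ ^ 4 := by
    rw [hT, Finset.sum_insert (by simp), Finset.sum_insert (by simp), Finset.sum_singleton]
    norm_num
    rw [show a 2 * a 3 + a 3 * a 2 = 2 * (a 2 * a 3) by ring, norm_mul, norm_mul]
    norm_num
    ring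
  rw [e2, e3, eT] at main
  linarith

/-- Bound for the terms of prime index, sharper than what Cauchy's inequality gives. -/
lemma sum_prime_le (ha : IsConvContraction a) {α β γ : ℝ} {lam : ℝ} (hβ : 0 ≤ β) (hβα : β ≤ α)
    (hlam0 : 0 < lam) (hdisc : (α * β) ^ 2 ≤ 2 * lam * (lam - α ^ 2))
    {Q : Finset ℕ} (hQ : ∀ p ∈ Q, p.Prime ∧ p ≠ 2 ∧ p ≠ 3) {c : ℕ → ℝ}
    (hc : ∑ p ∈ Q, c p ^ 2 ≤ γ) :
    ‖a 2‖ * α + ‖a 3‖ * β + ∑ p ∈ Q, ‖a p‖ * c p ≤ (1 - ‖a 1‖ ^ 2) * √(lam + γ) := by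
  have hblock := ha.two_three_block_le hQ
  have hR1 : ∑ p ∈ Q, ‖a p‖ ^ 2 ≤ (1 - ‖a 1‖ ^ 2) ^ 2 :=
    ha.sum_norm_sq_le one_pos fun p hp => ⟨(hQ p hp).1.ne_zero,
      ArithmeticFunction.cardFactors_apply_prime (hQ p hp).1⟩
  have hCS := Finset.sum_mul_sq_le_sq_mul_sq Q (fun p => ‖a p‖) c
  have hD := ha.one_sub_sq_nonneg
  have hR0 : 0 ≤ ∑ p ∈ Q, ‖a p‖ ^ 2 := Finset.sum_nonneg fun _ _ => by positivity
  have hγ : 0 ≤ γ := le_trans (Finset.sum_nonneg fun _ _ => by positivity) hc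
  have hX := norm_nonneg (a 2)
  have hY := norm_nonneg (a 3)
  have hCS' := hCS.trans (mul_le_mul_of_nonneg_left hc hR0)
  generalize ∑ p ∈ Q, ‖a p‖ * c p = ρ at *
  generalize ∑ p ∈ Q, ‖a p‖ ^ 2 = R at *
  generalize 1 - ‖a 1‖ ^ 2 = D at *
  generalize ‖a 2‖ = X at *
  generalize ‖a 3‖ = Y at *
  -- After β² is replaced by α² in the square on the left, this is a quadratic form in X² + Y² and
  -- XY, and `hdisc` is its discriminant condition. Plain Cauchy would need lam = α² + β².
  have hclaim : (X ^ 2 + Y ^ 2) * (X * α + Y * β) ^ 2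
      ≤ lam * ((X ^ 2 + Y ^ 2) ^ 2 + 2 * X ^ 2 * Y ^ 2) := by
    have h1 : (X * α + Y * β) ^ 2 ≤ α ^ 2 * (X ^ 2 + Y ^ 2) + 2 * (α * β) * (X * Y) := by
      nlinarith [mul_nonneg (sq_nonneg Y) (mul_nonneg (sub_nonneg.mpr hβα)
        (add_nonneg (hβ.trans hβα) hβ))]
    have h2 : 0 ≤ (lam - α ^ 2) * (X ^ 2 + Y ^ 2) ^ 2
        - 2 * (α * β) * ((X * Y) * (X ^ 2 + Y ^ 2)) + 2 * lam * (X * Y) ^ 2 := by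
      have h3 : 0 ≤ 2 * lam * ((lam - α ^ 2) * (X ^ 2 + Y ^ 2) ^ 2
        - 2 * (α * β) * ((X * Y) * (X ^ 2 + Y ^ 2)) + 2 * lam * (X * Y) ^ 2) := by
        nlinarith [sq_nonneg (α * β * (X ^ 2 + Y ^ 2) - 2 * lam * (X * Y)),
          mul_nonneg (sub_nonneg.mpr hdisc) (sq_nonneg (X ^ 2 + Y ^ 2))]
      exact nonneg_of_mul_nonneg_right h3 (by positivity)
    nlinarith [mul_le_mul_of_nonneg_left h1 (by positivity : 0 ≤ X ^ 2 + Y ^ 2)]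
  have hkey : (X * α + Y * β) ^ 2 / lam + R ≤ D ^ 2 := by
    rcases (by positivity : 0 ≤ X ^ 2 + Y ^ 2).eq_or_lt with h0 | h0
    · have hX0 : X = 0 := by nlinarith
      have hY0 : Y = 0 := by nlinarith
      simpa [hX0, hY0] using hR1
    · have h4 : (X ^ 2 + Y ^ 2) * ((X * α + Y * β) ^ 2 / lam)
          ≤ (X ^ 2 + Y ^ 2) ^ 2 + 2 * X ^ 2 * Y ^ 2 := by
        rw [← mul_div_assoc, div_le_iff₀ hlam0]
        linarith
      refine le_of_mul_le_mul_left ?_ h0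
      nlinarith
  -- Cauchy's inequality with weights lam and γ for the two parts, z²/lam and R.
  have hsq : (X * α + Y * β + ρ) ^ 2 ≤ D ^ 2 * (lam + γ) := by
    refine le_trans ?_ (mul_le_mul_of_nonneg_right hkey (by positivity))
    set z := X * α + Y * β
    have h5 : z ^ 2 / lam * lam = z ^ 2 := div_mul_cancel₀ _ hlam0.ne'
    have h6 : (2 * (z * ρ)) ^ 2 ≤ (z ^ 2 / lam * γ + R * lam) ^ 2 := by
      have h7 : 4 * (z ^ 2 / lam * γ * (R * lam)) ≤ (z ^ 2 / lam * γ + R * lam) ^ 2 := by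
        nlinarith [sq_nonneg (z ^ 2 / lam * γ - R * lam)]
      have h8 : z ^ 2 / lam * γ * (R * lam) = z ^ 2 * (R * γ) := by
        field_simp
      nlinarith [mul_le_mul_of_nonneg_left hCS' (sq_nonneg z)]
    have h9 : 2 * (z * ρ) ≤ z ^ 2 / lam * γ + R * lam := abs_le_of_sq_le_sq' h6 (by positivity) |>.2
    have h10 : (z ^ 2 / lam + R) * (lam + γ) = z ^ 2 + z ^ 2 / lam * γ + R * lam + R * γ := by
      linear_combination h5
    have h11 : (z + ρ) ^ 2 = z ^ 2 + 2 * (z * ρ) + ρ ^ 2 := by ring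
    linarith
  calc X * α + Y * β + ρ ≤ √(D ^ 2 * (lam + γ)) := Real.le_sqrt_of_sq_le hsq
    _ = D * √(lam + γ) := by rw [Real.sqrt_mul (by positivity), Real.sqrt_sq hD]

end IsConvContraction

/-! ### From block bounds to admissible exponents -/

lemma squareBohrInequality_iff {a : ℕ → ℂ} {σ : ℝ} :
    SquareBohrInequality a σ ↔
      ∀ S : Finset ℕ, (∀ n ∈ S, 2 ≤ n) → ∑ n ∈ S, ‖a n‖ * (n : ℝ) ^ (-σ) ≤ 1 - ‖a 1‖ ^ 2 := by
  have h0 : ∀ n : ℕ, 0 ≤ ‖a (n + 2)‖ * ((n + 2 : ℕ) : ℝ) ^ (-σ) := fun n => by positivity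
  constructor
  · rintro ⟨hs, hle⟩ S hS
    have himg : S = (S.image (· - 2)).image (· + 2) := by
      rw [Finset.image_image]
      ext n
      simp only [Finset.mem_image, Function.comp]
      constructor
      · intro h; exact ⟨n, h, by have := hS n h; omega⟩
      · rintro ⟨m, hm, rfl⟩; have := hS m hm; rwa [Nat.sub_add_cancel this]
    rw [himg, Finset.sum_image (fun _ _ _ _ h => by simpa using h)]
    have := hs.sum_le_tsum (S.image (· - 2)) (fun n _ => h0 n)
    linarith
  · intro h
    have hb : ∀ T : Finset ℕ, ∑ n ∈ T, ‖a (n + 2)‖ * ((n + 2 : ℕ) : ℝ) ^ (-σ)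
        ≤ 1 - ‖a 1‖ ^ 2 := fun T => by
      have := h (T.image (· + 2)) (by simp)
      rwa [Finset.sum_image (fun _ _ _ _ h => by simpa using h)] at this
    refine ⟨summable_of_sum_le h0 hb, ?_⟩
    have := Real.tsum_le_of_sum_le (f := fun n : ℕ => ‖a (n + 2)‖ * ((n + 2 : ℕ) : ℝ) ^ (-σ))
      h0 hb
    linarith

lemma SquareBohrInequality.mono {a : ℕ → ℂ} {σ τ : ℝ} (h : SquareBohrInequality a σ)
    (hst : σ ≤ τ) : SquareBohrInequality a τ := by
  rw [squareBohrInequality_iff] at h ⊢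
  refine fun S hS => le_trans (Finset.sum_le_sum fun n hn => ?_) (h S hS)
  have : (1 : ℝ) ≤ n := by exact_mod_cast (one_le_two.trans (hS n hn))
  gcongr

/-- Each finite partial sum is continuous in σ. This is why the infimum of the admissible exponents
is itself admissible. -/
lemma squareBohrInequality_of_forall_gt {a : ℕ → ℂ} {σ : ℝ}
    (h : ∀ τ, σ < τ → SquareBohrInequality a τ) : SquareBohrInequality a σ := by
  rw [squareBohrInequality_iff]
  intro S hS
  have hc : Continuous fun τ : ℝ => ∑ n ∈ S, ‖a n‖ * (n : ℝ) ^ (-τ) := by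
    refine continuous_finsetSum _ fun n hn => continuous_const.mul ?_
    have : (n : ℝ) ≠ 0 := by have := hS n hn; positivity
    exact (Real.continuous_const_rpow this).comp continuous_neg
  refine le_of_tendsto ((hc.tendsto σ).mono_left (nhdsWithin_le_nhds (s := Set.Ioi σ)))
    (eventually_mem_nhdsWithin.mono fun τ hτ => ?_)
  exact squareBohrInequality_iff.mp (h τ hτ) S hS

/-- Reduction of the square Bohr inequality to the blocks `Ω n = k`. -/
lemma squareBohrInequality_of_blocks {a : ℕ → ℂ} {σ : ℝ} (ha : ‖a 1‖ ≤ 1) {β : ℕ → ENNReal}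
    (hβ : ∑' k, β k ≤ 1)
    (h : ∀ k, ∀ S : Finset ℕ, (∀ n ∈ S, 2 ≤ n ∧ Ω n = k + 1) →
      ENNReal.ofReal (∑ n ∈ S, ‖a n‖ * (n : ℝ) ^ (-σ)) ≤ ENNReal.ofReal (1 - ‖a 1‖ ^ 2) * β k) :
    SquareBohrInequality a σ := by
  rw [squareBohrInequality_iff]
  intro S hS
  have hD : 0 ≤ 1 - ‖a 1‖ ^ 2 := by nlinarith [norm_nonneg (a 1)]
  rw [← ENNReal.ofReal_le_ofReal_iff hD]
  have hmap : ∀ n ∈ S, Ω n - 1 ∈ S.image (fun n => Ω n - 1) := fun n hn =>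
    Finset.mem_image_of_mem _ hn
  rw [← Finset.sum_fiberwise_of_maps_to hmap,
    ENNReal.ofReal_sum_of_nonneg fun k _ => Finset.sum_nonneg fun n _ => by positivity]
  calc _ ≤ ∑ k ∈ S.image (fun n => Ω n - 1), ENNReal.ofReal (1 - ‖a 1‖ ^ 2) * β k := by
        refine Finset.sum_le_sum fun k _ => h k _ fun n hn => ?_
        rw [Finset.mem_filter] at hn
        refine ⟨hS n hn.1, ?_⟩
        have : 0 < Ω n := ArithmeticFunction.cardFactors_pos_iff_one_lt.mpr (hS n hn.1)
        omega
    _ = ENNReal.ofReal (1 - ‖a 1‖ ^ 2) * ∑ k ∈ S.image (fun n => Ω n - 1), β k := by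
        rw [Finset.mul_sum]
    _ ≤ ENNReal.ofReal (1 - ‖a 1‖ ^ 2) * 1 := by
        gcongr
        exact (ENNReal.sum_le_tsum _).trans hβ
    _ = _ := mul_one _

/-- The series `∑_{Ω n = k, n ≠ 0} n ^ (-s)`. -/
noncomputable def omegaSeries (s : ℝ) (k : ℕ) : ENNReal :=
  ∑' n : ℕ, if n ≠ 0 ∧ Ω n = k then ENNReal.ofReal ((n : ℝ) ^ (-s)) else 0

lemma omegaBlockSum_eq (σ : ℝ) :
    omegaBlockSum σ = ∑' k : ℕ, omegaSeries (2 * σ) (k + 1) ^ (1 / 2 : ℝ) := by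
  unfold omegaBlockSum omegaSeries
  congr 1
  ext k
  congr 1
  have := tsum_subtype {n : ℕ | 2 ≤ n ∧ ArithmeticFunction.cardFactors n = k + 1}
    (fun n : ℕ => ENNReal.ofReal ((n : ℝ) ^ (-2 * σ)))
  refine this.trans (tsum_congr fun n => ?_)
  have hiff : (n ≠ 0 ∧ Ω n = k + 1) ↔
      n ∈ {n : ℕ | 2 ≤ n ∧ ArithmeticFunction.cardFactors n = k + 1} := by
    rw [Set.mem_ofPred_eq]
    refine and_congr_left fun h => ?_
    have : 0 < Ω n := by omega
    have := ArithmeticFunction.cardFactors_pos_iff_one_lt.mp this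
    omega
  rw [Set.indicator_apply, neg_mul]
  simp only [hiff]

lemma ofReal_sum_rpow_sq_le_omegaSeries {σ : ℝ} {k : ℕ} {S : Finset ℕ}
    (hS : ∀ n ∈ S, n ≠ 0 ∧ Ω n = k) :
    ENNReal.ofReal (∑ n ∈ S, ((n : ℝ) ^ (-σ)) ^ 2) ≤ omegaSeries (2 * σ) k := by
  rw [ENNReal.ofReal_sum_of_nonneg fun n _ => by positivity]
  refine le_trans (Finset.sum_le_sum fun n hn => ?_) (ENNReal.sum_le_tsum S)
  rw [if_pos (hS n hn), ← Real.rpow_natCast, ← Real.rpow_mul (by positivity)]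
  apply le_of_eq
  congr 2
  push_cast
  ring

/-- Cauchy's inequality with the ℓ² bound for the block. -/
lemma IsConvContraction.block_le {a : ℕ → ℂ} (ha : IsConvContraction a) (σ : ℝ) (k : ℕ)
    {S : Finset ℕ} (hS : ∀ n ∈ S, 2 ≤ n ∧ Ω n = k + 1) :
    ENNReal.ofReal (∑ n ∈ S, ‖a n‖ * (n : ℝ) ^ (-σ))
      ≤ ENNReal.ofReal (1 - ‖a 1‖ ^ 2) * omegaSeries (2 * σ) (k + 1) ^ (1 / 2 : ℝ) := by
  have hS' : ∀ n ∈ S, n ≠ 0 ∧ Ω n = k + 1 := fun n hn => ⟨by have := hS n hn; omega, (hS n hn).2⟩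
  have hD := ha.one_sub_sq_nonneg
  have h1 : ∑ n ∈ S, ‖a n‖ * (n : ℝ) ^ (-σ)
      ≤ (1 - ‖a 1‖ ^ 2) * √(∑ n ∈ S, ((n : ℝ) ^ (-σ)) ^ 2) := by
    refine (Real.sum_mul_le_sqrt_mul_sqrt _ _ _).trans ?_
    gcongr
    exact (Real.sqrt_le_sqrt (ha.sum_norm_sq_le k.succ_pos hS')).trans_eq (Real.sqrt_sq hD)
  refine (ENNReal.ofReal_le_ofReal h1).trans ?_
  rw [ENNReal.ofReal_mul hD, Real.sqrt_eq_rpow,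
    ← ENNReal.ofReal_rpow_of_nonneg (Finset.sum_nonneg fun _ _ => by positivity) (by norm_num)]
  gcongr
  exact ofReal_sum_rpow_sq_le_omegaSeries hS'

lemma mem_admissibleExponents_of_omegaBlockSum_le_one {σ : ℝ} (h : omegaBlockSum σ ≤ 1) :
    σ ∈ admissibleExponents := by
  intro a f hf ha h1
  have hc := isConvContraction_of_hInftyNorm_eq_one hf ha h1
  rw [omegaBlockSum_eq] at h
  exact squareBohrInequality_of_blocks hc.norm_one_le h fun k S hS => hc.block_le σ k hS

/-- Admissibility from a bound `κ` for the first block. -/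
lemma mem_admissibleExponents_of_first_block {σ κ : ℝ}
    (hκ : ∀ a : ℕ → ℂ, IsConvContraction a → ∀ S : Finset ℕ, (∀ p ∈ S, p.Prime) →
      ∑ p ∈ S, ‖a p‖ * (p : ℝ) ^ (-σ) ≤ (1 - ‖a 1‖ ^ 2) * κ)
    (h : ENNReal.ofReal κ + ∑' k : ℕ, omegaSeries (2 * σ) (k + 2) ^ (1 / 2 : ℝ) ≤ 1) :
    σ ∈ admissibleExponents := by
  intro a f hf ha h1
  have hc := isConvContraction_of_hInftyNorm_eq_one hf ha h1
  refine squareBohrInequality_of_blocks hc.norm_one_le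
    (β := fun k => if k = 0 then ENNReal.ofReal κ else omegaSeries (2 * σ) (k + 1) ^ (1 / 2 : ℝ))
    ?_ fun k S hS => ?_
  · rw [tsum_eq_zero_add' ENNReal.summable]
    simpa using h
  · rcases k with _ | k
    · rw [if_pos rfl, ← ENNReal.ofReal_mul hc.one_sub_sq_nonneg]
      exact ENNReal.ofReal_le_ofReal (hκ a hc S fun p hp =>
        ArithmeticFunction.cardFactors_eq_one_iff_prime.mp (hS p hp).2)
    · rw [if_neg k.succ_ne_zero]
      exact hc.block_le σ (k + 1) hS

lemma one_mem_admissibleExponentsPowersOfTwo : (1 : ℝ) ∈ admissibleExponentsPowersOfTwo := by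
  intro a f hf ha hpow h1
  have hc := isConvContraction_of_hInftyNorm_eq_one hf ha h1
  have hD := hc.one_sub_sq_nonneg
  -- Only 2^(k+1) survives in block k, so its weight is 2^{-(k+1)} and the weights add up to exactly
  -- 1.
  refine squareBohrInequality_of_blocks hc.norm_one_le
    (β := fun k => ENNReal.ofReal ((1 / 2 : ℝ) ^ (k + 1))) ?_ fun k S hS => ?_
  · rw [← ENNReal.ofReal_tsum_of_nonneg (fun n => by positivity)
      ((summable_nat_add_iff 1).mpr summable_geometric_two)]
    simp_rw [pow_succ]
    rw [tsum_mul_right, tsum_geometric_two]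
    norm_num
  · rw [← ENNReal.ofReal_mul hD]
    apply ENNReal.ofReal_le_ofReal
    have hΩ : Ω (2 ^ (k + 1)) = k + 1 :=
      ArithmeticFunction.cardFactors_apply_prime_pow Nat.prime_two
    have hcoef : ‖a (2 ^ (k + 1))‖ ≤ 1 - ‖a 1‖ ^ 2 := by
      have := hc.sum_norm_sq_le (k := k + 1) k.succ_pos (W := {2 ^ (k + 1)})
        (by intro n hn; rw [Finset.mem_singleton.mp hn]; exact ⟨by positivity, hΩ⟩)
      rw [Finset.sum_singleton] at this
      exact abs_le_of_sq_le_sq' this hD |>.2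
    calc ∑ n ∈ S, ‖a n‖ * (n : ℝ) ^ (-1 : ℝ)
        ≤ ∑ n ∈ ({2 ^ (k + 1)} : Finset ℕ), ‖a n‖ * (n : ℝ) ^ (-1 : ℝ) := by
          rw [← Finset.sum_filter_of_ne (s := S) (p := fun n => n = 2 ^ (k + 1))]
          · refine Finset.sum_le_sum_of_subset_of_nonneg (fun n hn => ?_)
              fun n _ _ => by positivity
            rw [Finset.mem_singleton, (Finset.mem_filter.mp hn).2]
          intro n hn hne
          by_contra hn2
          refine hne ?_
          rw [hpow n fun j hj => hn2 ?_, norm_zero, zero_mul]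
          have := (hS n hn).2
          rw [hj, ArithmeticFunction.cardFactors_apply_prime_pow Nat.prime_two] at this
          rw [hj, this]
      _ = ‖a (2 ^ (k + 1))‖ * (1 / 2) ^ (k + 1) := by
          rw [Finset.sum_singleton, Real.rpow_neg_one]
          push_cast
          rw [one_div, inv_pow]
      _ ≤ _ := by gcongr

/-! ### Möbius functions of 2^{-s} and the lower bound 1 -/

/-- The Taylor coefficients of `(A - z) / (1 - A z)`. -/
def moebiusCoeff (A : ℝ) : ℕ → ℂ
  | 0 => A
  | k + 1 => -((1 - A ^ 2) * A ^ k)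

/-- The coefficients of `(A - 2 ^ (-s)) / (1 - A 2 ^ (-s))` as a Dirichlet series. -/
noncomputable def moebiusDirichletCoeff (A : ℝ) : ℕ → ℂ :=
  Function.extend (fun k : ℕ => 2 ^ k) (moebiusCoeff A) 0

lemma moebiusDirichletCoeff_two_pow (A : ℝ) (k : ℕ) :
    moebiusDirichletCoeff A (2 ^ k) = moebiusCoeff A k :=
  (Nat.pow_right_injective le_rfl).extend_apply _ _ k

lemma moebiusDirichletCoeff_eq_zero (A : ℝ) {n : ℕ} (hn : ∀ k : ℕ, n ≠ 2 ^ k) :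
    moebiusDirichletCoeff A n = 0 :=
  Function.extend_apply' _ _ _ fun ⟨k, hk⟩ => hn k hk.symm

lemma hasSum_moebiusCoeff {A : ℝ} (hA : 0 ≤ A) (hA1 : A < 1) {z : ℂ} (hz : ‖z‖ ≤ 1) :
    HasSum (fun k => moebiusCoeff A k * z ^ k) ((A - z) / (1 - A * z)) := by
  have hAz : ‖(A : ℂ) * z‖ < 1 := by
    rw [norm_mul, Complex.norm_real, Real.norm_of_nonneg hA]
    nlinarith [norm_nonneg z]
  have hne : 1 - (A : ℂ) * z ≠ 0 := by
    intro h
    rw [← sub_eq_zero.mp h] at hAz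
    simp at hAz
  have h1 := (hasSum_geometric_of_norm_lt_one hAz).mul_left (-((1 - (A : ℂ) ^ 2) * z))
  rw [← hasSum_nat_add_iff' 1]
  convert h1 using 1
  · rfl
  · ext k
    rw [moebiusCoeff, mul_pow]
    ring
  · rw [Finset.sum_range_one, moebiusCoeff]
    field_simp
    ring

lemma norm_moebius_le {A : ℝ} (hA : 0 ≤ A) (hA1 : A < 1) {z : ℂ} (hz : ‖z‖ ≤ 1) :
    ‖((A : ℂ) - z) / (1 - A * z)‖ ≤ 1 := by
  rw [norm_div]
  refine div_le_one_of_le₀ ?_ (norm_nonneg _)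
  refine abs_le_of_sq_le_sq' ?_ (norm_nonneg _) |>.2
  have hz2 : ‖z‖ ^ 2 ≤ 1 := pow_le_one₀ (norm_nonneg _) hz
  rw [Complex.sq_norm, Complex.normSq_apply] at hz2 ⊢
  rw [Complex.sq_norm, Complex.normSq_apply]
  simp only [Complex.sub_re, Complex.sub_im, Complex.ofReal_re, Complex.ofReal_im,
    Complex.mul_re, Complex.mul_im, Complex.one_re, Complex.one_im]
  -- This product is |1 - Az|² - |A - z|².
  have : 0 ≤ (1 - A ^ 2) * (1 - (z.re * z.re + z.im * z.im)) :=
    mul_nonneg (by nlinarith) (by linarith)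
  nlinarith

/-- The function `(A - 2 ^ (-s)) / (1 - A 2 ^ (-s))`. -/
noncomputable def moebiusDirichlet (A : ℝ) (s : ℂ) : ℂ :=
  (A - (2 : ℂ) ^ (-s)) / (1 - A * (2 : ℂ) ^ (-s))

lemma norm_two_cpow_neg_le {s : ℂ} (hs : 0 ≤ s.re) : ‖(2 : ℂ) ^ (-s)‖ ≤ 1 := by
  have : ‖((2 : ℝ) : ℂ) ^ (-s)‖ ≤ 1 := by
    rw [Complex.norm_cpow_eq_rpow_re_of_pos two_pos]
    exact Real.rpow_le_one_of_one_le_of_nonpos one_le_two (by simpa using hs)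
  simpa using this

lemma one_sub_mul_two_cpow_ne_zero {A : ℝ} (hA : 0 ≤ A) (hA1 : A < 1) {s : ℂ} (hs : 0 ≤ s.re) :
    1 - (A : ℂ) * (2 : ℂ) ^ (-s) ≠ 0 := by
  intro h
  have h1 : ‖(A : ℂ) * (2 : ℂ) ^ (-s)‖ = 1 := by rw [← sub_eq_zero.mp h, norm_one]
  rw [norm_mul, Complex.norm_real, Real.norm_of_nonneg hA] at h1
  nlinarith [norm_two_cpow_neg_le hs, norm_nonneg ((2 : ℂ) ^ (-s))]

lemma natCast_two_pow_cpow (k : ℕ) (s : ℂ) : ((2 ^ k : ℕ) : ℂ) ^ s = ((2 : ℂ) ^ s) ^ k := by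
  induction k with
  | zero => simp
  | succ k ih =>
    rw [pow_succ, Nat.cast_mul, Complex.natCast_mul_natCast_cpow, ih, pow_succ]
    norm_num

lemma isDirichletSeriesOf_moebiusDirichlet {A : ℝ} (hA : 0 ≤ A) (hA1 : A < 1) :
    IsDirichletSeriesOf (moebiusDirichletCoeff A) (moebiusDirichlet A) := by
  intro s hs
  have h1 := hasSum_moebiusCoeff hA hA1 (norm_two_cpow_neg_le (le_of_lt hs))
  have h2 : HasSum (fun n : ℕ => moebiusDirichletCoeff A n / (n : ℂ) ^ s)
      (moebiusDirichlet A s) := by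
    rw [← (Nat.pow_right_injective le_rfl).hasSum_iff (g := fun k : ℕ => 2 ^ k)]
    · refine (congrArg (HasSum · _) (funext fun k => ?_)).mpr h1
      rw [Function.comp, moebiusDirichletCoeff_two_pow, natCast_two_pow_cpow, Complex.cpow_neg,
        inv_pow, div_eq_mul_inv]
    · intro n hn
      rw [moebiusDirichletCoeff_eq_zero A fun k hk => hn ⟨k, hk.symm⟩, zero_div]
  have h3 := h2.tendsto_sum_nat.comp (tendsto_add_atTop_nat 1)
  refine h3.congr fun N => ?_
  rw [Function.comp, Finset.sum_range_succ', sum_Icc_one_eq_sum_range,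
    moebiusDirichletCoeff_eq_zero A fun k => (pow_ne_zero k two_ne_zero).symm, zero_div, add_zero]

lemma differentiableOn_moebiusDirichlet {A : ℝ} (hA : 0 ≤ A) (hA1 : A < 1) :
    DifferentiableOn ℂ (moebiusDirichlet A) {s | 0 ≤ s.re} := by
  unfold moebiusDirichlet
  have h : Differentiable ℂ fun s : ℂ => (2 : ℂ) ^ (-s) := fun s =>
    (differentiableAt_id.neg).const_cpow (Or.inl two_ne_zero)
  refine DifferentiableOn.div ?_ ?_ fun s hs => one_sub_mul_two_cpow_ne_zero hA hA1 hs
  · exact (h.const_sub _).differentiableOn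
  · exact ((h.const_mul _).const_sub _).differentiableOn

lemma norm_moebiusDirichlet_le {A : ℝ} (hA : 0 ≤ A) (hA1 : A < 1) {s : ℂ} (hs : 0 ≤ s.re) :
    ‖moebiusDirichlet A s‖ ≤ 1 := norm_moebius_le hA hA1 (norm_two_cpow_neg_le hs)

lemma memHInfty_moebiusDirichlet {A : ℝ} (hA : 0 ≤ A) (hA1 : A < 1) :
    MemHInfty (moebiusDirichlet A) where
  holomorphic := (differentiableOn_moebiusDirichlet hA hA1).mono fun s hs => show 0 ≤ s.re from le_of_lt hs
  bounded := ⟨1, by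
    rintro _ ⟨s, hs, rfl⟩
    exact norm_moebiusDirichlet_le hA hA1 (le_of_lt hs)⟩

lemma hInftyNorm_moebiusDirichlet {A : ℝ} (hA : 0 ≤ A) (hA1 : A < 1) :
    hInftyNorm (moebiusDirichlet A) = 1 := by
  apply le_antisymm
  · refine csSup_le ⟨_, 1, by simp [rightHalfPlane], rfl⟩ ?_
    rintro _ ⟨s, hs, rfl⟩
    exact norm_moebiusDirichlet_le hA hA1 (le_of_lt hs)
  · have hval : ‖moebiusDirichlet A 0‖ = 1 := by
      have : (1 : ℂ) - A ≠ 0 := by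
        rw [sub_ne_zero]; exact_mod_cast hA1.ne'
      rw [moebiusDirichlet, neg_zero, Complex.cpow_zero, mul_one, ← neg_sub, neg_div,
        div_self this]
      simp
    have hc : ContinuousWithinAt (moebiusDirichlet A) rightHalfPlane 0 :=
      ((differentiableOn_moebiusDirichlet hA hA1).continuousOn 0 (by simp)).mono
        fun s hs => show 0 ≤ s.re from le_of_lt hs
    have hT : Tendsto (fun n : ℕ => ((1 / ((n : ℝ) + 1) : ℝ) : ℂ)) atTop (𝓝[rightHalfPlane] 0) := by
      refine tendsto_nhdsWithin_iff.mpr ⟨?_, Eventually.of_forall fun n => ?_⟩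
      · have := (Complex.continuous_ofReal.tendsto 0).comp
          (tendsto_one_div_add_atTop_nhds_zero_nat (𝕜 := ℝ))
        simpa only [Function.comp_def, Complex.ofReal_zero] using this
      · change 0 < (((1 / ((n : ℝ) + 1) : ℝ) : ℂ)).re
        rw [Complex.ofReal_re]
        positivity
    have h2 := (hc.tendsto.comp hT).norm
    rw [hval] at h2
    refine le_of_tendsto' h2 fun n => ?_
    refine le_csSup (memHInfty_moebiusDirichlet hA hA1).bounded ⟨_, ?_, rfl⟩
    change 0 < (((1 / ((n : ℝ) + 1) : ℝ) : ℂ)).re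
    rw [Complex.ofReal_re]
    positivity

lemma one_le_of_mem_admissibleExponentsPowersOfTwo {σ : ℝ}
    (h : σ ∈ admissibleExponentsPowersOfTwo) : 1 ≤ σ := by
  by_contra hσ
  push Not at hσ
  set r : ℝ := 2 ^ (-σ) with hr
  have hr2 : 1 / 2 < r := by
    rw [hr, one_div, ← Real.rpow_neg_one]
    exact Real.rpow_lt_rpow_of_exponent_lt one_lt_two (by linarith)
  have hr0 : 0 < r := by linarith
  -- With Ar = 1/2 the Bohr sum without its first term is (1 - A²) · 2r, which exceeds 1 - A²
  -- exactly when r > 1/2; that inequality also gives A < 1.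
  set A : ℝ := 1 / (2 * r) with hAdef
  have hA : 0 ≤ A := by positivity
  have hA1 : A < 1 := by rw [hAdef, div_lt_one (by positivity)]; linarith
  have hAr : A * r = 1 / 2 := by rw [hAdef]; field_simp
  have hB := squareBohrInequality_iff.mp (h _ _ (memHInfty_moebiusDirichlet hA hA1)
    (isDirichletSeriesOf_moebiusDirichlet hA hA1) (fun n hn => moebiusDirichletCoeff_eq_zero A hn)
    (hInftyNorm_moebiusDirichlet hA hA1))
  have hA2 : 0 < 1 - A ^ 2 := by nlinarith
  have ha1 : ‖moebiusDirichletCoeff A 1‖ = A := by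
    rw [show (1 : ℕ) = 2 ^ 0 by norm_num, moebiusDirichletCoeff_two_pow, moebiusCoeff,
      Complex.norm_real, Real.norm_of_nonneg hA]
  have hsum : ∀ K : ℕ, ∑ k ∈ Finset.range K, (1 / 2 : ℝ) ^ k ≤ 1 / r := by
    intro K
    have h1 := hB ((Finset.range K).image fun k => 2 ^ (k + 1)) (by
      intro n hn
      obtain ⟨k, -, rfl⟩ := Finset.mem_image.mp hn
      exact Nat.le_self_pow k.succ_ne_zero 2)
    rw [Finset.sum_image (fun _ _ _ _ h => by simpa using h), ha1] at h1
    have h2 : ∑ k ∈ Finset.range K, ‖moebiusDirichletCoeff A (2 ^ (k + 1))‖ *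
        ((2 ^ (k + 1) : ℕ) : ℝ) ^ (-σ)
        = (1 - A ^ 2) * r * ∑ k ∈ Finset.range K, (1 / 2 : ℝ) ^ k := by
      rw [Finset.mul_sum]
      refine Finset.sum_congr rfl fun k _ => ?_
      have e1 : ‖moebiusDirichletCoeff A (2 ^ (k + 1))‖ = (1 - A ^ 2) * A ^ k := by
        rw [moebiusDirichletCoeff_two_pow, moebiusCoeff, norm_neg]
        have : ((1 : ℂ) - A ^ 2) * A ^ k = (((1 - A ^ 2) * A ^ k : ℝ) : ℂ) := by push_cast; rfl
        rw [this, Complex.norm_real, Real.norm_of_nonneg (by positivity)]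
      have e2 : ((2 ^ (k + 1) : ℕ) : ℝ) ^ (-σ) = r ^ (k + 1) := by
        rw [hr, ← Real.rpow_natCast, ← Real.rpow_mul two_pos.le, mul_comm, Real.rpow_mul two_pos.le,
          Real.rpow_natCast]
        push_cast
        rfl
      rw [e1, e2, ← hAr, mul_pow]
      ring
    rw [h2, mul_assoc] at h1
    have h3 : r * ∑ k ∈ Finset.range K, (1 / 2 : ℝ) ^ k ≤ 1 := by
      refine le_of_mul_le_mul_left ?_ hA2
      linarith
    rw [le_div_iff₀ hr0]
    linarith
  have hlim : (2 : ℝ) ≤ 1 / r :=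
    le_of_tendsto' hasSum_geometric_two.tendsto_sum_nat hsum
  rw [le_div_iff₀ hr0] at hlim
  linarith

lemma isLeast_admissibleExponentsPowersOfTwo : IsLeast admissibleExponentsPowersOfTwo 1 :=
  ⟨one_mem_admissibleExponentsPowersOfTwo, fun _ => one_le_of_mem_admissibleExponentsPowersOfTwo⟩

lemma one_le_of_mem_admissibleExponents {σ : ℝ} (h : σ ∈ admissibleExponents) : 1 ≤ σ :=
  one_le_of_mem_admissibleExponentsPowersOfTwo fun a f hf ha _ h1 => h a f hf ha h1

lemma exists_isLeast_admissibleExponents {σ : ℝ} (h : σ ∈ admissibleExponents) :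
    ∃ τ, IsLeast admissibleExponents τ ∧ 1 ≤ τ ∧ τ ≤ σ := by
  have hbdd : BddBelow admissibleExponents := ⟨1, fun _ => one_le_of_mem_admissibleExponents⟩
  have hmem : sInf admissibleExponents ∈ admissibleExponents := by
    intro a f hf ha h1
    refine squareBohrInequality_of_forall_gt fun τ hτ => ?_
    obtain ⟨ρ, hρ, hρτ⟩ := exists_lt_of_csInf_lt ⟨σ, h⟩ hτ
    exact (hρ a f hf ha h1).mono hρτ.le
  exact ⟨_, ⟨hmem, fun _ hρ => csInf_le hbdd hρ⟩, one_le_of_mem_admissibleExponents hmem,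
    csInf_le hbdd h⟩

/-! ### Upper bounds for the block sums by splitting off primes -/

/-- `n ^ (-s)` as an extended nonnegative real. -/
noncomputable def natRpow (s : ℝ) (n : ℕ) : ENNReal := ENNReal.ofReal ((n : ℝ) ^ (-s))

lemma natRpow_mul (s : ℝ) (m n : ℕ) : natRpow s (m * n) = natRpow s m * natRpow s n := by
  rw [natRpow, natRpow, natRpow, ← ENNReal.ofReal_mul (by positivity), Nat.cast_mul,
    Real.mul_rpow (by positivity) (by positivity)]

/-- The sum of `n ^ (-s)` over the `n` with `Ω n = k` that no element of `P` divides. -/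
noncomputable def roughOmegaSeries (s : ℝ) (P : Finset ℕ) (k : ℕ) : ENNReal :=
  ∑' n : ℕ, if n ≠ 0 ∧ Ω n = k ∧ ∀ q ∈ P, ¬ q ∣ n then natRpow s n else 0

/-- The sum of `n ^ (-s)` over the `n` that no element of `P` divides. -/
noncomputable def roughZeta (s : ℝ) (P : Finset ℕ) : ENNReal :=
  ∑' n : ℕ, if n ≠ 0 ∧ ∀ q ∈ P, ¬ q ∣ n then natRpow s n else 0

lemma omegaSeries_eq_roughOmegaSeries (s : ℝ) (k : ℕ) :
    omegaSeries s k = roughOmegaSeries s ∅ k := by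
  simp [omegaSeries, roughOmegaSeries, natRpow]

lemma tsum_eq_tsum_mul_add_tsum_not_dvd {p : ℕ} (hp : 0 < p) (G : ℕ → ENNReal) :
    ∑' n, G n = ∑' m, G (p * m) + ∑' n, if p ∣ n then 0 else G n := by
  have h1 : ∑' m, G (p * m) = ∑' n, if p ∣ n then G n else 0 := by
    have hinj : Function.Injective fun m : ℕ => p * m := fun _ _ h => Nat.eq_of_mul_eq_mul_left hp h
    rw [← hinj.tsum_eq (f := fun n => if p ∣ n then G n else 0)]
    · exact tsum_congr fun m => by rw [if_pos (dvd_mul_right _ _)]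
    · intro n hn
      rw [Function.mem_support] at hn
      by_contra h
      exact hn (if_neg fun ⟨m, hm⟩ => h ⟨m, hm.symm⟩)
  rw [h1, ← ENNReal.tsum_add]
  refine tsum_congr fun n => ?_
  split_ifs <;> simp

lemma forall_not_dvd_mul_iff {P : Finset ℕ} (hP : ∀ q ∈ P, q.Prime) {p : ℕ} (hp : p.Prime)
    (hpP : p ∉ P) (m : ℕ) : (∀ q ∈ P, ¬ q ∣ p * m) ↔ ∀ q ∈ P, ¬ q ∣ m := by
  refine forall₂_congr fun q hq => not_congr ?_
  rw [(hP q hq).dvd_mul, or_iff_right]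
  intro h
  rw [(Nat.prime_dvd_prime_iff_eq (hP q hq) hp).mp h] at hq
  exact hpP hq

/-- Either p divides n, and n/p lies one level lower, or it does not. In the generating function ∑
t^k over the levels this splits off the factor 1/(1 - p^{-s}t). -/
lemma roughOmegaSeries_succ (s : ℝ) {P : Finset ℕ} (hP : ∀ q ∈ P, q.Prime) {p : ℕ} (hp : p.Prime)
    (hpP : p ∉ P) (k : ℕ) : roughOmegaSeries s P (k + 1)
      = natRpow s p * roughOmegaSeries s P k + roughOmegaSeries s (insert p P) (k + 1) := by
  conv_lhs => rw [roughOmegaSeries, tsum_eq_tsum_mul_add_tsum_not_dvd hp.pos]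
  congr 1
  · rw [roughOmegaSeries, ← ENNReal.tsum_mul_left]
    refine tsum_congr fun m => ?_
    rw [mul_ite, mul_zero, ← natRpow_mul]
    refine if_congr ?_ rfl rfl
    rw [forall_not_dvd_mul_iff hP hp hpP]
    by_cases hm : m = 0
    · simp [hm]
    · rw [ArithmeticFunction.cardFactors_mul hp.ne_zero hm,
        ArithmeticFunction.cardFactors_apply_prime hp, add_comm 1, Nat.add_right_cancel_iff]
      simp [hm, hp.ne_zero]
  · refine tsum_congr fun n => ?_
    rw [← ite_not, ← ite_and]
    refine if_congr ?_ rfl rfl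
    rw [Finset.forall_mem_insert]
    tauto

lemma roughZeta_eq (s : ℝ) {P : Finset ℕ} (hP : ∀ q ∈ P, q.Prime) {p : ℕ} (hp : p.Prime)
    (hpP : p ∉ P) :
    roughZeta s P = natRpow s p * roughZeta s P + roughZeta s (insert p P) := by
  conv_lhs => rw [roughZeta, tsum_eq_tsum_mul_add_tsum_not_dvd hp.pos]
  congr 1
  · rw [roughZeta, ← ENNReal.tsum_mul_left]
    refine tsum_congr fun m => ?_
    rw [mul_ite, mul_zero, ← natRpow_mul]
    refine if_congr ?_ rfl rfl
    rw [forall_not_dvd_mul_iff hP hp hpP]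
    simp [hp.ne_zero]
  · refine tsum_congr fun n => ?_
    rw [← ite_not, ← ite_and]
    refine if_congr ?_ rfl rfl
    rw [Finset.forall_mem_insert]
    tauto

lemma roughOmegaSeries_zero (s : ℝ) {P : Finset ℕ} (hP : ∀ q ∈ P, q.Prime) :
    roughOmegaSeries s P 0 = 1 := by
  rw [roughOmegaSeries, tsum_eq_single 1]
  · rw [if_pos ⟨one_ne_zero, by simp, fun q hq h => (hP q hq).one_lt.ne' (Nat.dvd_one.mp h)⟩]
    simp [natRpow]
  · intro n hn
    refine if_neg fun h => ?_
    rcases ArithmeticFunction.cardFactors_eq_zero_iff_eq_zero_or_one.mp h.2.1 with h0 | h1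
    · exact h.1 h0
    · exact hn h1

/-- The number 1 and the primes outside P are among the integers counted on the right. This bounds a
sum over large primes by a zeta value with its small Euler factors removed. -/
lemma one_add_roughOmegaSeries_one_le (s : ℝ) {P : Finset ℕ} (hP : ∀ q ∈ P, q.Prime) :
    1 + roughOmegaSeries s P 1 ≤ roughZeta s P := by
  rw [← roughOmegaSeries_zero s hP, roughOmegaSeries, roughOmegaSeries, roughZeta,
    ← ENNReal.tsum_add]
  refine ENNReal.tsum_le_tsum fun n => ?_
  by_cases h0 : n ≠ 0 ∧ ∀ q ∈ P, ¬ q ∣ n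
  · rw [if_pos h0]
    by_cases h1 : Ω n = 0
    · rw [if_neg (c := n ≠ 0 ∧ Ω n = 1 ∧ _) (by omega), add_zero]
      split_ifs <;> simp
    · rw [if_neg (c := n ≠ 0 ∧ Ω n = 0 ∧ _) (by omega), zero_add]
      split_ifs <;> simp
  · rw [if_neg fun h => h0 ⟨h.1, h.2.2⟩, if_neg fun h => h0 ⟨h.1, h.2.2⟩, add_zero]
    exact zero_le

/-- Splitting off the least prime factor is injective from level k + 1 into level 1 times level k.
-/
lemma roughOmegaSeries_succ_le (s : ℝ) (P : Finset ℕ) (k : ℕ) :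
    roughOmegaSeries s P (k + 1) ≤ roughOmegaSeries s P 1 * roughOmegaSeries s P k := by
  set φ : ℕ → ℕ × ℕ := fun n => (n.minFac, n / n.minFac) with hφ
  have hmul : ∀ n : ℕ, n.minFac * (n / n.minFac) = n := fun n => Nat.mul_div_cancel' n.minFac_dvd
  have hinj : Function.Injective φ := fun m n h => by
    rw [hφ, Prod.mk.injEq] at h
    rw [← hmul m, ← hmul n, h.2, h.1]
  set H : ℕ → ℕ → ENNReal := fun k n =>
    if n ≠ 0 ∧ Ω n = k ∧ ∀ q ∈ P, ¬ q ∣ n then natRpow s n else 0 with hH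
  change ∑' n, H (k + 1) n ≤ (∑' n, H 1 n) * ∑' n, H k n
  calc ∑' n, H (k + 1) n ≤ ∑' n, (fun x : ℕ × ℕ => H 1 x.1 * H k x.2) (φ n) := by
        refine ENNReal.tsum_le_tsum fun n => ?_
        by_cases h : n ≠ 0 ∧ Ω n = k + 1 ∧ ∀ q ∈ P, ¬ q ∣ n
        · obtain ⟨hn0, hΩ, hq⟩ := h
          have hp : n.minFac.Prime := Nat.minFac_prime fun h1 => by simp [h1] at hΩ
          have hd0 : n / n.minFac ≠ 0 := fun h0 => hn0 (by rw [← hmul n, h0, mul_zero])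
          have hΩp := ArithmeticFunction.cardFactors_apply_prime hp
          have hΩd : Ω (n / n.minFac) = k := by
            have := ArithmeticFunction.cardFactors_mul hp.ne_zero hd0
            rw [hmul, hΩ, hΩp] at this
            omega
          have e1 : H 1 n.minFac = natRpow s n.minFac :=
            if_pos ⟨hp.ne_zero, hΩp, fun q hqP hd => hq q hqP (hd.trans n.minFac_dvd)⟩
          have e2 : H k (n / n.minFac) = natRpow s (n / n.minFac) :=
            if_pos ⟨hd0, hΩd, fun q hqP hd =>
              hq q hqP (hd.trans (Nat.div_dvd_of_dvd n.minFac_dvd))⟩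
          have e3 : H (k + 1) n = natRpow s n := if_pos ⟨hn0, hΩ, hq⟩
          simp only [hφ]
          rw [e1, e2, e3, ← natRpow_mul, hmul]
        · rw [show H (k + 1) n = 0 from if_neg h]
          exact zero_le
    _ ≤ ∑' x : ℕ × ℕ, H 1 x.1 * H k x.2 := ENNReal.tsum_comp_le_tsum_of_injective hinj _
    _ = (∑' n, H 1 n) * ∑' n, H k n := by
        rw [ENNReal.tsum_prod (f := fun i j => H 1 i * H k j)]
        simp_rw [ENNReal.tsum_mul_left, ENNReal.tsum_mul_right]

lemma roughOmegaSeries_le_pow (s : ℝ) {P : Finset ℕ} (hP : ∀ q ∈ P, q.Prime) (k : ℕ) :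
    roughOmegaSeries s P k ≤ roughOmegaSeries s P 1 ^ k := by
  induction k with
  | zero => rw [roughOmegaSeries_zero s hP, pow_zero]
  | succ k ih =>
    rw [pow_succ']
    exact (roughOmegaSeries_succ_le s P k).trans (by gcongr)

/-- The Hermite-Hadamard inequality for `x ^ (-t - 1)` on an interval of length one. -/
lemma mul_rpow_le_sub_half {t : ℝ} (ht : 0 < t) {x : ℝ} (hx : 1 ≤ x) :
    t * x ^ (-(t + 1)) ≤ (x - 1 / 2) ^ (-t) - (x + 1 / 2) ^ (-t) := by
  -- φ(0) = 0, φ(1/2) ≥ 0 is the claim, and φ' ≥ 0 is midpoint convexity of y^{-(t+1)}, obtained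
  -- from AM-GM and x² - h² ≤ x².
  set φ : ℝ → ℝ := fun h => (x - h) ^ (-t) - (x + h) ^ (-t) - 2 * h * (t * x ^ (-(t + 1))) with hφ
  have hd : ∀ h ∈ Set.Icc (0 : ℝ) (1 / 2), HasDerivAt φ (t * ((x - h) ^ (-(t + 1)) +
      (x + h) ^ (-(t + 1)) - 2 * x ^ (-(t + 1)))) h := by
    intro h hh
    have h1 : HasDerivAt (fun h => (x - h) ^ (-t)) (-1 * -t * (x - h) ^ (-t - 1)) h :=
      ((hasDerivAt_id h).const_sub x).rpow_const (Or.inl (by have := hh.2; simp only [id]; linarith))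
    have h2 : HasDerivAt (fun h => (x + h) ^ (-t)) (1 * -t * (x + h) ^ (-t - 1)) h :=
      ((hasDerivAt_id h).const_add x).rpow_const (Or.inl (by have := hh.1; simp only [id]; linarith))
    have h3 : HasDerivAt (fun h => 2 * h * (t * x ^ (-(t + 1)))) (2 * 1 * (t * x ^ (-(t + 1)))) h :=
      ((hasDerivAt_id h).const_mul 2).mul_const _
    refine ((h1.sub h2).sub h3).congr_deriv ?_
    rw [show -t - 1 = -(t + 1) by ring]
    ring
  have hmono : MonotoneOn φ (Set.Icc 0 (1 / 2)) := by
    refine monotoneOn_of_deriv_nonneg (convex_Icc _ _)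
      (fun h hh => (hd h hh).continuousAt.continuousWithinAt)
      (fun h hh => (hd h (interior_subset hh)).differentiableAt.differentiableWithinAt)
      fun h hh => ?_
    have hh' := interior_subset hh
    rw [(hd h hh').deriv]
    refine mul_nonneg ht.le ?_
    have hp1 : 0 < x - h := by linarith [hh'.2]
    have hp2 : 0 < x + h := by linarith [hh'.1]
    have e : ∀ y : ℝ, 0 < y → y ^ (-(t + 1)) = (y ^ (-(t + 1) / 2)) ^ 2 := fun y hy => by
      rw [← Real.rpow_natCast, ← Real.rpow_mul hy.le]; norm_num
    have hle : x ^ (-(t + 1)) ≤ (x - h) ^ (-(t + 1) / 2) * (x + h) ^ (-(t + 1) / 2) := by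
      rw [← Real.mul_rpow hp1.le hp2.le, e x (by linarith), ← Real.rpow_natCast,
        ← Real.rpow_mul (by linarith), mul_comm (-(t + 1) / 2), Real.rpow_mul (by linarith),
        Real.rpow_natCast]
      refine Real.rpow_le_rpow_of_nonpos (by positivity) ?_ (by linarith)
      nlinarith [sq_nonneg h]
    rw [e _ hp1, e _ hp2]
    nlinarith [sq_nonneg ((x - h) ^ (-(t + 1) / 2) - (x + h) ^ (-(t + 1) / 2))]
  have := hmono (Set.left_mem_Icc.mpr (by norm_num)) (Set.right_mem_Icc.mpr (by norm_num))
    (by norm_num)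
  simp only [hφ] at this
  norm_num at this
  rw [neg_add_rev]
  linarith

/-- The midpoint comparison telescopes and starts at N - 1/2 rather than N - 1, so few explicit
terms suffice. -/
lemma tsum_natRpow_add_le {t : ℝ} (ht : 0 < t) {N : ℕ} (hN : 0 < N) :
    ∑' n, natRpow (t + 1) (n + N) ≤ ENNReal.ofReal (((N : ℝ) - 1 / 2) ^ (-t) / t) := by
  refine ENNReal.tsum_le_of_sum_range_le fun m => ?_
  unfold natRpow
  rw [← ENNReal.ofReal_sum_of_nonneg fun _ _ => by positivity]
  apply ENNReal.ofReal_le_ofReal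
  rw [le_div_iff₀ ht, Finset.sum_mul]
  have hN1 : (1 : ℝ) ≤ N := by exact_mod_cast hN
  calc ∑ i ∈ Finset.range m, ((i + N : ℕ) : ℝ) ^ (-(t + 1)) * t
      ≤ ∑ i ∈ Finset.range m, (((N : ℝ) + i - 1 / 2) ^ (-t)
          - ((N : ℝ) + (i + 1 : ℕ) - 1 / 2) ^ (-t)) := by
        refine Finset.sum_le_sum fun i _ => ?_
        have h := mul_rpow_le_sub_half ht (x := ((i + N : ℕ) : ℝ))
          (by push_cast; linarith [Nat.cast_nonneg (α := ℝ) i])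
        rw [mul_comm]
        refine h.trans_eq ?_
        push_cast
        congr 2 <;> ring
    _ = ((N : ℝ) - 1 / 2) ^ (-t) - ((N : ℝ) + m - 1 / 2) ^ (-t) := by
        rw [Finset.sum_range_sub' fun i : ℕ => ((N : ℝ) + i - 1 / 2) ^ (-t)]
        simp
    _ ≤ _ := by
        have : 0 ≤ ((N : ℝ) + m - 1 / 2) ^ (-t) := by
          apply Real.rpow_nonneg
          linarith [Nat.cast_nonneg (α := ℝ) m]
        linarith

lemma roughZeta_empty_le {t : ℝ} (ht : 0 < t) {N : ℕ} :
    roughZeta (t + 1) ∅ ≤ ∑ n ∈ Finset.range N, natRpow (t + 1) (n + 1)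
      + ENNReal.ofReal (((N : ℝ) + 1 / 2) ^ (-t) / t) := by
  have h1 : roughZeta (t + 1) ∅ = ∑' n, natRpow (t + 1) (n + 1) := by
    rw [roughZeta, tsum_eq_zero_add' ENNReal.summable]
    simp
  rw [h1, ← Summable.sum_add_tsum_nat_add' (k := N) ENNReal.summable]
  gcongr
  have := tsum_natRpow_add_le ht (N := N + 1) N.succ_pos
  simp_rw [add_assoc, add_comm N 1] at this ⊢
  refine this.trans_eq ?_
  push_cast
  congr 3
  ring

lemma roughZeta_insert_le {s : ℝ} {P : Finset ℕ} (hP : ∀ q ∈ P, q.Prime) {p : ℕ} (hp : p.Prime)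
    (hpP : p ∉ P) {z l : ℝ} (hl0 : 0 ≤ l) (hl1 : l ≤ 1) (hl : l ≤ (p : ℝ) ^ (-s))
    (hz : roughZeta s P ≤ ENNReal.ofReal z) :
    roughZeta s (insert p P) ≤ ENNReal.ofReal (z * (1 - l)) := by
  have hfin : roughZeta s P ≠ ⊤ := ne_top_of_le_ne_top ENNReal.ofReal_ne_top hz
  have h1 := roughZeta_eq s hP hp hpP
  have h2 : ENNReal.ofReal l * roughZeta s P + roughZeta s (insert p P)
      ≤ ENNReal.ofReal l * roughZeta s P + ENNReal.ofReal (1 - l) * roughZeta s P := by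
    rw [← add_mul, ← ENNReal.ofReal_add hl0 (by linarith), add_sub_cancel, ENNReal.ofReal_one,
      one_mul]
    conv_rhs => rw [h1]
    gcongr
    exact ENNReal.ofReal_le_ofReal hl
  have h3 := (ENNReal.add_le_add_iff_left (ENNReal.mul_ne_top ENNReal.ofReal_ne_top hfin)).mp h2
  refine h3.trans ?_
  rw [mul_comm z, ENNReal.ofReal_mul (by linarith)]
  gcongr

lemma roughOmegaSeries_one_le {s : ℝ} {P : Finset ℕ} (hP : ∀ q ∈ P, q.Prime) {z : ℝ}
    (hz : roughZeta s P ≤ ENNReal.ofReal z) :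
    roughOmegaSeries s P 1 ≤ ENNReal.ofReal (z - 1) := by
  have h := (one_add_roughOmegaSeries_one_le s hP).trans hz
  rw [ENNReal.ofReal_sub _ zero_le_one, ENNReal.ofReal_one]
  exact ENNReal.le_sub_of_add_le_left ENNReal.one_ne_top h

/-- The coefficients of `U(t) / (1 - x t)`, when `u 0 = 1`. -/
def geomConv {R : Type*} [CommSemiring R] (x : R) (u : ℕ → R) : ℕ → R
  | 0 => 1
  | k + 1 => x * geomConv x u k + u (k + 1)

/-- The complete homogeneous symmetric polynomial of degree `k` in `w` and the values of `x` at
the entries of a list. -/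
def completeSymm {R : Type*} [CommSemiring R] (x : ℕ → R) (w : R) : List ℕ → ℕ → R
  | [] => fun k => w ^ k
  | p :: ps => geomConv (x p) (completeSymm x w ps)

lemma geomConv_nonneg {x : ℝ} (hx : 0 ≤ x) {u : ℕ → ℝ} (hu : ∀ k, 0 ≤ u k) (k : ℕ) :
    0 ≤ geomConv x u k := by
  induction k with
  | zero => exact zero_le_one
  | succ k ih => exact add_nonneg (mul_nonneg hx ih) (hu _)

lemma completeSymm_nonneg {x : ℕ → ℝ} (hx : ∀ p, 0 ≤ x p) {w : ℝ} (hw : 0 ≤ w) (ps : List ℕ)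
    (k : ℕ) : 0 ≤ completeSymm x w ps k := by
  induction ps generalizing k with
  | nil => exact pow_nonneg hw k
  | cons p ps ih => exact geomConv_nonneg (hx p) ih k

lemma geomConv_div {M : ℝ} (x : ℕ) {u : ℕ → ℕ} {v : ℕ → ℝ} (hv : ∀ k, v k = u k / M ^ k) (k : ℕ) :
    geomConv ((x : ℝ) / M) v k = (geomConv x u k : ℕ) / M ^ k := by
  induction k with
  | zero => simp [geomConv]
  | succ k ih =>
    rw [geomConv, ih, hv, geomConv]
    push_cast
    rw [add_div, pow_succ']
    congr 1
    rw [div_mul_div_comm]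

/-- Homogeneity clears the common denominator M, leaving arithmetic in ℕ that the kernel can decide.
-/
lemma completeSymm_div (M : ℝ) (x : ℕ → ℕ) (w : ℕ) (ps : List ℕ) (k : ℕ) :
    completeSymm (fun p => (x p : ℝ) / M) ((w : ℝ) / M) ps k
      = (completeSymm x w ps k : ℕ) / M ^ k := by
  induction ps generalizing k with
  | nil => simp [completeSymm, div_pow]
  | cons p ps ih => exact geomConv_div (x p) ih k

/-- The listed primes are kept as separate variables. All others are lumped into one variable w
bounding the sum of their p^{-s}, because their level k is at most the k-th power of their level 1;
`hzw` supplies w from a zeta bound. -/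
lemma roughOmegaSeries_le_completeSymm {s : ℝ} {x l : ℕ → ℝ} {w : ℝ} (hw : 0 ≤ w)
    (hx : ∀ p, 0 ≤ x p) {ps : List ℕ}
    (hps : ∀ p ∈ ps, p.Prime ∧ 0 ≤ l p ∧ l p ≤ 1 ∧ l p ≤ (p : ℝ) ^ (-s) ∧ (p : ℝ) ^ (-s) ≤ x p)
    (hnd : ps.Nodup) {P : Finset ℕ} (hP : ∀ q ∈ P, q.Prime) (hPps : ∀ p ∈ ps, p ∉ P) {z : ℝ}
    (hz : roughZeta s P ≤ ENNReal.ofReal z) (hzw : z * (ps.map fun p => 1 - l p).prod ≤ 1 + w)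
    (k : ℕ) : roughOmegaSeries s P k ≤ ENNReal.ofReal (completeSymm x w ps k) := by
  induction ps generalizing P z k with
  | nil =>
    refine (roughOmegaSeries_le_pow s hP k).trans ?_
    rw [completeSymm, ENNReal.ofReal_pow hw]
    gcongr
    refine (roughOmegaSeries_one_le hP hz).trans (ENNReal.ofReal_le_ofReal ?_)
    simp only [List.map_nil, List.prod_nil, mul_one] at hzw
    linarith
  | cons p ps ih =>
    obtain ⟨hp, hl0, hl1, hl, hpx⟩ := hps p List.mem_cons_self
    have hpP := hPps p List.mem_cons_self
    have hnd' := List.nodup_cons.mp hnd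
    have hins : ∀ k, roughOmegaSeries s (insert p P) k
        ≤ ENNReal.ofReal (completeSymm x w ps k) := by
      intro k
      refine ih (fun q hq => hps q (List.mem_cons_of_mem _ hq)) hnd'.2 ?_ ?_
        (roughZeta_insert_le hP hp hpP hl0 hl1 hl hz) ?_ k
      · rw [Finset.forall_mem_insert]; exact ⟨hp, hP⟩
      · intro q hq
        rw [Finset.mem_insert, not_or]
        exact ⟨fun h => hnd'.1 (h ▸ hq), hPps q (List.mem_cons_of_mem _ hq)⟩
      · rwa [mul_assoc, ← List.prod_cons, ← List.map_cons (f := fun p => 1 - l p)]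
    induction k with
    | zero => rw [roughOmegaSeries_zero s hP]; simp [completeSymm, geomConv]
    | succ k ihk =>
      rw [roughOmegaSeries_succ s hP hp hpP]
      change _ ≤ ENNReal.ofReal (x p * completeSymm x w (p :: ps) k + completeSymm x w ps (k + 1))
      rw [ENNReal.ofReal_add (mul_nonneg (hx p) (completeSymm_nonneg hx hw _ _))
        (completeSymm_nonneg hx hw _ _), ENNReal.ofReal_mul (hx p)]
      gcongr
      · exact ENNReal.ofReal_le_ofReal hpx
      · exact hins _

/-! ### Reduction to integer certificates -/

lemma rpow_neg_div_le {x q : ℝ} (hx : 0 < x) (hq : 0 ≤ q) {a b : ℕ} (hb : b ≠ 0)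
    (h : 1 ≤ q ^ b * x ^ a) : x ^ (-((a : ℝ) / b)) ≤ q := by
  have h1 : (x ^ (-((a : ℝ) / b))) ^ b = (x ^ a)⁻¹ := by
    have : (b : ℝ) ≠ 0 := by exact_mod_cast hb
    rw [← Real.rpow_natCast, ← Real.rpow_mul hx.le, neg_mul, div_mul_cancel₀ _ this,
      Real.rpow_neg hx.le, Real.rpow_natCast]
  refine le_of_pow_le_pow_left₀ hb hq ?_
  rw [h1]
  rwa [inv_le_iff_one_le_mul₀ (by positivity)]

lemma le_rpow_neg_div {x q : ℝ} (hx : 0 < x) {a b : ℕ} (hb : b ≠ 0)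
    (h : q ^ b * x ^ a ≤ 1) : q ≤ x ^ (-((a : ℝ) / b)) := by
  have h1 : (x ^ (-((a : ℝ) / b))) ^ b = (x ^ a)⁻¹ := by
    have : (b : ℝ) ≠ 0 := by exact_mod_cast hb
    rw [← Real.rpow_natCast, ← Real.rpow_mul hx.le, neg_mul, div_mul_cancel₀ _ this,
      Real.rpow_neg hx.le, Real.rpow_natCast]
  refine le_of_pow_le_pow_left₀ hb (by positivity) ?_
  rwa [h1, ← one_div, le_div_iff₀ (by positivity)]

lemma natCast_rpow_neg_div_le {n X M a b : ℕ} (hn : 0 < n) (hM : 0 < M) (hb : b ≠ 0)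
    (h : M ^ b ≤ X ^ b * n ^ a) : (n : ℝ) ^ (-((a : ℝ) / b)) ≤ (X : ℝ) / M := by
  refine rpow_neg_div_le (by exact_mod_cast hn) (by positivity) hb ?_
  rw [div_pow, div_mul_eq_mul_div, one_le_div (by positivity)]
  exact_mod_cast h

lemma le_natCast_rpow_neg_div {n X M a b : ℕ} (hn : 0 < n) (hM : 0 < M) (hb : b ≠ 0)
    (h : X ^ b * n ^ a ≤ M ^ b) : (X : ℝ) / M ≤ (n : ℝ) ^ (-((a : ℝ) / b)) := by
  refine le_rpow_neg_div (by exact_mod_cast hn) hb ?_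
  rw [div_pow, div_mul_eq_mul_div, div_le_one (by positivity)]
  exact_mod_cast h

lemma omegaSeries_succ_le (s : ℝ) (k : ℕ) :
    omegaSeries s (k + 1) ≤ omegaSeries s 1 * omegaSeries s k := by
  simp_rw [omegaSeries_eq_roughOmegaSeries]
  exact roughOmegaSeries_succ_le s ∅ k

lemma ofReal_sq_rpow_half {y : ℝ} (hy : 0 ≤ y) :
    ENNReal.ofReal (y ^ 2) ^ (1 / 2 : ℝ) = ENNReal.ofReal y := by
  rw [ENNReal.ofReal_rpow_of_nonneg (by positivity) (by norm_num), ← Real.sqrt_eq_rpow,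
    Real.sqrt_sq hy]

/-- Summation of the block norms: finitely many terms, then a geometric series. -/
lemma tsum_rpow_half_omegaSeries_le {s ρ : ℝ} {y : ℕ → ℝ} (i m : ℕ) (hmi : 0 < m + i)
    (hy0 : ∀ k, 0 ≤ y k)
    (hy : ∀ k, 1 ≤ k → k ≤ m + i → omegaSeries s k ≤ ENNReal.ofReal (y k ^ 2))
    (hρ0 : 0 ≤ ρ) (hρ1 : ρ < 1) (hyρ : y 1 ≤ ρ) :
    ∑' k, omegaSeries s (k + i + 1) ^ (1 / 2 : ℝ)
      ≤ ENNReal.ofReal (∑ k ∈ Finset.range m, y (k + i + 1) + y (m + i) * (ρ / (1 - ρ))) := by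
  have h1 : omegaSeries s 1 ≤ ENNReal.ofReal (ρ ^ 2) :=
    (hy 1 le_rfl hmi).trans (ENNReal.ofReal_le_ofReal (by have := hy0 1; gcongr))
  -- Beyond level m + i, submultiplicativity lets each further level cost a factor ρ². The offset i
  -- is the number of initial blocks left out of the sum.
  have hdecay : ∀ j, omegaSeries s (m + i + j) ≤ ENNReal.ofReal ((y (m + i) * ρ ^ j) ^ 2) := by
    intro j
    induction j with
    | zero => simpa using hy (m + i) hmi le_rfl
    | succ j ih =>
      refine (omegaSeries_succ_le s _).trans ((mul_le_mul' h1 ih).trans ?_)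
      rw [← ENNReal.ofReal_mul (by positivity)]
      apply ENNReal.ofReal_le_ofReal
      apply le_of_eq
      ring
  rw [← Summable.sum_add_tsum_nat_add' (k := m) ENNReal.summable,
    ENNReal.ofReal_add (Finset.sum_nonneg fun _ _ => hy0 _)
      (mul_nonneg (hy0 _) (div_nonneg hρ0 (by linarith))),
    ENNReal.ofReal_sum_of_nonneg fun _ _ => hy0 _]
  gcongr with k hk
  · rw [← ofReal_sq_rpow_half (hy0 _)]
    gcongr
    have := Finset.mem_range.mp hk
    exact hy _ (by omega) (by omega)
  · calc ∑' k, omegaSeries s (k + m + i + 1) ^ (1 / 2 : ℝ)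
        ≤ ∑' k : ℕ, ENNReal.ofReal (y (m + i) * ρ * ρ ^ k) := by
          refine ENNReal.tsum_le_tsum fun k => ?_
          rw [mul_assoc, ← pow_succ', ← ofReal_sq_rpow_half (mul_nonneg (hy0 _) (by positivity))]
          gcongr
          rw [show k + m + i + 1 = m + i + (k + 1) by ring]
          exact hdecay _
      _ = ENNReal.ofReal (y (m + i) * (ρ / (1 - ρ))) := by
          rw [← ENNReal.ofReal_tsum_of_nonneg
            (fun k => mul_nonneg (mul_nonneg (hy0 _) hρ0) (by positivity))
            ((summable_geometric_of_lt_one hρ0 hρ1).mul_left _), tsum_mul_left,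
            tsum_geometric_of_lt_one hρ0 hρ1]
          congr 1
          ring
      _ ≤ _ := le_rfl

/-- An upper bound for `ζ(s)` from an integer certificate: `X n / M` bounds `n ^ (-s)`, and
`T / M` bounds the tail. -/
lemma roughZeta_empty_le_of_certificate {a b c N M T : ℕ} {X : ℕ → ℕ}
    (hb : b ≠ 0) (hM : 0 < M) (hc : 0 < c) (hac : a = c + b)
    (hX : ∀ n < N, M ^ b ≤ X (n + 1) ^ b * (n + 1) ^ a)
    (hT : ((N : ℝ) + 1 / 2) ^ (-((c : ℝ) / b)) / ((c : ℝ) / b) ≤ (T : ℝ) / M) :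
    roughZeta ((a : ℝ) / b) ∅
      ≤ ENNReal.ofReal (((∑ n ∈ Finset.range N, X (n + 1) : ℕ) + T : ℝ) / M) := by
  have hb0 : (0 : ℝ) < b := by exact_mod_cast Nat.pos_of_ne_zero hb
  have hs : (a : ℝ) / b = (c : ℝ) / b + 1 := by
    rw [hac]; push_cast; field_simp
  rw [hs]
  refine (roughZeta_empty_le (by positivity) (N := N)).trans ?_
  rw [add_div, ENNReal.ofReal_add (by positivity) (by positivity)]
  gcongr
  push_cast
  rw [Finset.sum_div, ENNReal.ofReal_sum_of_nonneg fun _ _ => by positivity]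
  refine Finset.sum_le_sum fun n hn => ENNReal.ofReal_le_ofReal ?_
  rw [← hs]
  exact natCast_rpow_neg_div_le n.succ_pos hM hb (hX n (Finset.mem_range.mp hn))

/-- Upper bounds for the block sums from an integer certificate: in addition, `L p / M` bounds
`p ^ (-s)` from below, and `W / M` bounds the rough part. -/
lemma omegaSeries_le_of_certificate {a b c N M T W : ℕ} {X L : ℕ → ℕ} {ps : List ℕ}
    (hb : b ≠ 0) (hM : 0 < M) (hc : 0 < c) (hac : a = c + b)
    (hX : ∀ n < N, M ^ b ≤ X (n + 1) ^ b * (n + 1) ^ a)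
    (hps : ∀ p ∈ ps, p.Prime ∧ p ≤ N ∧ L p ≤ M ∧ L p ^ b * p ^ a ≤ M ^ b)
    (hnd : ps.Nodup)
    (hT : ((N : ℝ) + 1 / 2) ^ (-((c : ℝ) / b)) / ((c : ℝ) / b) ≤ (T : ℝ) / M)
    (hW : ((∑ n ∈ Finset.range N, X (n + 1) : ℕ) + T : ℝ) / M *
      (ps.map fun p => 1 - (L p : ℝ) / M).prod ≤ 1 + (W : ℝ) / M) (k : ℕ) :
    omegaSeries ((a : ℝ) / b) k ≤ ENNReal.ofReal ((completeSymm X W ps k : ℕ) / (M : ℝ) ^ k) := by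
  rw [omegaSeries_eq_roughOmegaSeries, ← completeSymm_div]
  refine roughOmegaSeries_le_completeSymm (l := fun p => (L p : ℝ) / M) (by positivity)
    (fun p => by positivity) (fun p hp => ?_) hnd (by simp) (by simp)
    (roughZeta_empty_le_of_certificate hb hM hc hac hX hT) hW k
  obtain ⟨hp1, hpN, hLM, hLp⟩ := hps p hp
  refine ⟨hp1, by positivity, ?_, le_natCast_rpow_neg_div hp1.pos hM hb hLp, ?_⟩
  · rw [div_le_one (by exact_mod_cast hM)]
    exact_mod_cast hLM
  · have := natCast_rpow_neg_div_le (p - 1).succ_pos hM hb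
      (hX (p - 1) (by have := hp1.pos; omega))
    rwa [Nat.succ_eq_add_one, Nat.sub_add_cancel hp1.one_le] at this

lemma omegaSeries_le_sq_of_completeSymm_le {s : ℝ} {M W : ℕ} (hM : 0 < M) {X Y : ℕ → ℕ}
    {ps : List ℕ} {k : ℕ}
    (h : omegaSeries s k ≤ ENNReal.ofReal ((completeSymm X W ps k : ℕ) / (M : ℝ) ^ k))
    (hY : completeSymm X W ps k * M ^ 2 ≤ Y k ^ 2 * M ^ k) :
    omegaSeries s k ≤ ENNReal.ofReal (((Y k : ℝ) / M) ^ 2) := by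
  refine h.trans (ENNReal.ofReal_le_ofReal ?_)
  rw [div_pow, div_le_div_iff₀ (by positivity) (by positivity)]
  exact_mod_cast hY

/-! ### Certificates at 2σ = 345/143 and 2σ = 12/5 -/

/-- Upper bounds for `10 ^ 8 * n ^ (-345 / 143)`. -/
def rpowCert (n : ℕ) : ℕ :=
  [0, 100000000, 18781870, 7061603, 3527587, 2059083, 1326301, 914381, 662547, 498663, 386735,
    307291, 249105, 205360, 171738, 145405, 124439].getD n 0

/-- Upper bounds for `10 ^ 8` times the square roots of the block sums at `345 / 143`. -/
def sqrtCert (n : ℕ) : ℕ :=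
  [0, 54529024, 25417715, 11303217, 4945168, 2150704, 933304, 404677, 175412, 76026, 32949, 14280,
    6189, 2682, 1163].getD n 0

lemma omegaSeries_le_rpowCert (k : ℕ) : omegaSeries (((345 : ℕ) : ℝ) / (143 : ℕ)) k
    ≤ ENNReal.ofReal ((completeSymm rpowCert 404556 [2, 3, 5, 7, 11, 13] k : ℕ)
      / ((100000000 : ℕ) : ℝ) ^ k) := by
  -- The tail exponent is 345/143 - 1 = 202/143. The table entries are rounded up by at most one
  -- unit, so subtracting 1 gives lower bounds; 404556/10^8 bounds the sum over the primes from 17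
  -- on.
  refine omegaSeries_le_of_certificate (c := 202) (N := 16) (T := 1349530)
    (L := fun p => rpowCert p - 1) (by norm_num) (by norm_num)
    (by norm_num) (by norm_num) (by decide +kernel) (by decide +kernel) (by decide) ?_ ?_ k
  · have h : (((16 : ℕ) : ℝ) + 1 / 2) ^ (-(((202 : ℕ) : ℝ) / (143 : ℕ))) ≤ 1906328 / 100000000 := by
      refine rpow_neg_div_le (by norm_num) (by norm_num) (by norm_num) ?_
      norm_num
    rw [div_le_iff₀ (by norm_num)]
    refine h.trans ?_
    norm_num
  · have hs : ∑ n ∈ Finset.range 16, rpowCert (n + 1) = 136422108 := by decide +kernel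
    rw [hs]
    norm_num [rpowCert]

lemma omegaBlockSum_lt_one : omegaBlockSum (345 / 286) < 1 := by
  rw [omegaBlockSum_eq, show (2 : ℝ) * (345 / 286) = ((345 : ℕ) : ℝ) / (143 : ℕ) by norm_num]
  have hY : ∀ k, 1 ≤ k → k ≤ 14 → omegaSeries (((345 : ℕ) : ℝ) / (143 : ℕ)) k
      ≤ ENNReal.ofReal (((sqrtCert k : ℝ) / (100000000 : ℕ)) ^ 2) := by
    have hdec : ∀ k < 15, 1 ≤ k →
        completeSymm rpowCert 404556 [2, 3, 5, 7, 11, 13] k * 100000000 ^ 2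
          ≤ sqrtCert k ^ 2 * 100000000 ^ k := by
      decide +kernel
    exact fun k hk1 hk => omegaSeries_le_sq_of_completeSymm_le (by norm_num)
      (omegaSeries_le_rpowCert k) (hdec k (by omega) hk1)
  -- The ratio 6/11 lies just above the first entry 0.54529024; the total stays below 1 by about 6 ·
  -- 10⁻⁵.
  refine (tsum_rpow_half_omegaSeries_le (ρ := 6 / 11)
    (y := fun k => (sqrtCert k : ℝ) / (100000000 : ℕ)) 0 14 (by norm_num) (fun k => by positivity)
    hY (by norm_num) (by norm_num) (by norm_num [sqrtCert])).trans_lt ?_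
  rw [ENNReal.ofReal_lt_one, ← Finset.sum_div, ← Nat.cast_sum]
  have hs : ∑ k ∈ Finset.range 14, sqrtCert (k + 0 + 1) = 99992510 := by decide +kernel
  rw [hs]
  norm_num [sqrtCert]

/-- Upper bounds for `10 ^ 4 * n ^ (-12 / 5)`. -/
def rpowCert' (n : ℕ) : ℕ := [0, 10000, 1895, 716].getD n 0

/-- Upper bounds for `10 ^ 4` times the square roots of the block sums at `12 / 5`. -/
def sqrtCert' (n : ℕ) : ℕ := [0, 5510, 2598, 1166, 514, 225, 98].getD n 0

lemma roughZeta_cert' :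
    (((3 : ℕ) : ℝ) + 1 / 2) ^ (-(((7 : ℕ) : ℝ) / (5 : ℕ))) / (((7 : ℕ) : ℝ) / (5 : ℕ))
      ≤ ((1238 : ℕ) : ℝ) / (10000 : ℕ) := by
  have h : (((3 : ℕ) : ℝ) + 1 / 2) ^ (-(((7 : ℕ) : ℝ) / (5 : ℕ))) ≤ 1732 / 10000 := by
    refine rpow_neg_div_le (by norm_num) (by norm_num) (by norm_num) ?_
    norm_num
  rw [div_le_iff₀ (by norm_num)]
  refine h.trans ?_
  norm_num

lemma omegaSeries_le_rpowCert' (k : ℕ) : omegaSeries (((12 : ℕ) : ℝ) / (5 : ℕ)) k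
    ≤ ENNReal.ofReal ((completeSymm rpowCert' 424 [2, 3] k : ℕ) / ((10000 : ℕ) : ℝ) ^ k) := by
  refine omegaSeries_le_of_certificate (c := 7) (N := 3) (T := 1238)
    (L := fun p => rpowCert' p - 1) (by norm_num) (by norm_num)
    (by norm_num) (by norm_num) (by decide +kernel) (by decide +kernel) (by decide)
    roughZeta_cert' ?_ k
  norm_num [rpowCert', Finset.sum_range_succ]

lemma tsum_omegaSeries_add_two_le :
    ∑' k : ℕ, omegaSeries (2 * (6 / 5)) (k + 2) ^ (1 / 2 : ℝ) ≤ ENNReal.ofReal (4725 / 10000) := by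
  rw [show (2 : ℝ) * (6 / 5) = ((12 : ℕ) : ℝ) / (5 : ℕ) by norm_num]
  have hY : ∀ k, 1 ≤ k → k ≤ 6 → omegaSeries (((12 : ℕ) : ℝ) / (5 : ℕ)) k
      ≤ ENNReal.ofReal (((sqrtCert' k : ℝ) / (10000 : ℕ)) ^ 2) := by
    have hdec : ∀ k < 7, 1 ≤ k → completeSymm rpowCert' 424 [2, 3] k * 10000 ^ 2
        ≤ sqrtCert' k ^ 2 * 10000 ^ k := by
      decide +kernel
    exact fun k hk1 hk => omegaSeries_le_sq_of_completeSymm_le (by norm_num)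
      (omegaSeries_le_rpowCert' k) (hdec k (by omega) hk1)
  refine (tsum_rpow_half_omegaSeries_le (ρ := 5 / 9)
    (y := fun k => (sqrtCert' k : ℝ) / (10000 : ℕ)) 1 5 (by norm_num) (fun k => by positivity)
    hY (by norm_num) (by norm_num) (by norm_num [sqrtCert'])).trans
      (ENNReal.ofReal_le_ofReal ?_)
  norm_num [sqrtCert', Finset.sum_range_succ]

lemma sum_sq_rpow_le_of_prime {Q : Finset ℕ} (hQ : ∀ p ∈ Q, p.Prime ∧ p ≠ 2 ∧ p ≠ 3) :
    ∑ p ∈ Q, ((p : ℝ) ^ (-(6 / 5) : ℝ)) ^ 2 ≤ 424 / 10000 := by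
  have hz := roughZeta_empty_le_of_certificate (a := 12) (b := 5) (c := 7) (N := 3) (M := 10000)
    (T := 1238) (X := rpowCert') (by norm_num) (by norm_num) (by norm_num) (by norm_num)
    (by decide +kernel) roughZeta_cert'
  have h2 := roughZeta_insert_le (by simp) Nat.prime_two (by simp)
    (l := ((1894 : ℕ) : ℝ) / (10000 : ℕ)) (by norm_num) (by norm_num)
    (le_natCast_rpow_neg_div (by norm_num) (by norm_num) (by norm_num) (by norm_num)) hz
  have h3 := roughZeta_insert_le (by simp [Nat.prime_two]) Nat.prime_three (by simp)
    (l := ((715 : ℕ) : ℝ) / (10000 : ℕ)) (by norm_num) (by norm_num)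
    (le_natCast_rpow_neg_div (by norm_num) (by norm_num) (by norm_num) (by norm_num)) h2
  have h1 := roughOmegaSeries_one_le (by simp [Nat.prime_two, Nat.prime_three]) h3
  rw [← ENNReal.ofReal_le_ofReal_iff (by norm_num)]
  calc ENNReal.ofReal (∑ p ∈ Q, ((p : ℝ) ^ (-(6 / 5) : ℝ)) ^ 2)
      ≤ roughOmegaSeries (((12 : ℕ) : ℝ) / (5 : ℕ)) (insert 3 (insert 2 ∅)) 1 := by
        rw [ENNReal.ofReal_sum_of_nonneg fun n _ => by positivity]
        refine le_trans (Finset.sum_le_sum fun p hp => ?_) (ENNReal.sum_le_tsum Q)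
        obtain ⟨hp1, hp2, hp3⟩ := hQ p hp
        have hnd : ∀ q ∈ (insert 3 (insert 2 ∅) : Finset ℕ), ¬ q ∣ p := by
          intro q hq
          simp only [Finset.mem_insert, Finset.notMem_empty, or_false] at hq
          rcases hq with rfl | rfl
          · exact fun h => hp3 ((Nat.prime_dvd_prime_iff_eq Nat.prime_three hp1).mp h).symm
          · exact fun h => hp2 ((Nat.prime_dvd_prime_iff_eq Nat.prime_two hp1).mp h).symm
        rw [if_pos ⟨hp1.ne_zero, ArithmeticFunction.cardFactors_apply_prime hp1, hnd⟩, natRpow,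
          ← Real.rpow_natCast, ← Real.rpow_mul (by positivity)]
        apply le_of_eq
        congr 2
        norm_num
    _ ≤ _ := h1
    _ ≤ _ := by
        apply ENNReal.ofReal_le_ofReal
        norm_num [rpowCert', Finset.sum_range_succ]

lemma sixFifths_mem_admissibleExponents : (6 / 5 : ℝ) ∈ admissibleExponents := by
  -- Here lam = 0.225 meets the discriminant condition, against α² + β² ≈ 0.261, and 0.0424 bounds
  -- the primes from 5 on. The first block is thus at most 0.5175 and the others 0.4725, total 0.99.
  refine mem_admissibleExponents_of_first_block (κ := √(225 / 1000 + 424 / 10000)) ?_ ?_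
  · intro a ha S hS
    set T : Finset ℕ := insert 2 (insert 3 (S \ {2, 3})) with hT
    have hx2 : (2 : ℝ) ^ (-(12 / 5) : ℝ) ≤ 1895 / 10000 := by
      have := natCast_rpow_neg_div_le (n := 2) (X := 1895) (M := 10000) (a := 12) (b := 5)
        (by norm_num) (by norm_num) (by norm_num) (by norm_num)
      norm_num at this ⊢
      exact this
    have hx3 : (3 : ℝ) ^ (-(12 / 5) : ℝ) ≤ 716 / 10000 := by
      have := natCast_rpow_neg_div_le (n := 3) (X := 716) (M := 10000) (a := 12) (b := 5)
        (by norm_num) (by norm_num) (by norm_num) (by norm_num)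
      norm_num at this ⊢
      exact this
    have hsq : ∀ x : ℝ, 0 ≤ x → (x ^ (-(6 / 5) : ℝ)) ^ 2 = x ^ (-(12 / 5) : ℝ) := fun x hx => by
      rw [← Real.rpow_natCast, ← Real.rpow_mul hx]; norm_num
    have hQ : ∀ p ∈ S \ {2, 3}, p.Prime ∧ p ≠ 2 ∧ p ≠ 3 := fun p hp => by
      rw [Finset.mem_sdiff, Finset.mem_insert, Finset.mem_singleton, not_or] at hp
      exact ⟨hS p hp.1, hp.2⟩
    have hST : S ⊆ T := fun p hp => by
      rw [hT, Finset.mem_insert, Finset.mem_insert, Finset.mem_sdiff, Finset.mem_insert,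
        Finset.mem_singleton]
      tauto
    have h0 : 0 < (2 : ℝ) ^ (-(12 / 5) : ℝ) := by positivity
    have h0' : 0 < (3 : ℝ) ^ (-(12 / 5) : ℝ) := by positivity
    have main := ha.sum_prime_le (α := (2 : ℝ) ^ (-(6 / 5) : ℝ)) (β := (3 : ℝ) ^ (-(6 / 5) : ℝ))
      (γ := 424 / 10000) (lam := 225 / 1000) (by positivity)
      (Real.rpow_le_rpow_of_nonpos (by norm_num) (by norm_num) (by norm_num)) (by norm_num)
      (by
        rw [mul_pow, hsq _ (by norm_num), hsq _ (by norm_num)]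
        nlinarith)
      hQ (c := fun p => (p : ℝ) ^ (-(6 / 5) : ℝ)) (sum_sq_rpow_le_of_prime hQ)
    refine le_trans (Finset.sum_le_sum_of_subset_of_nonneg hST fun _ _ _ => by positivity) ?_
    rw [hT, Finset.sum_insert (by simp), Finset.sum_insert (by simp), ← add_assoc]
    exact main
  · refine (add_le_add_right tsum_omegaSeries_add_two_le _).trans ?_
    rw [← ENNReal.ofReal_add (by positivity) (by norm_num), ENNReal.ofReal_le_one]
    have : √(225 / 1000 + 424 / 10000 : ℝ) ≤ 5175 / 10000 := by
      rw [Real.sqrt_le_left (by norm_num)]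
      norm_num
    linarith

/-! ### Strict decrease and continuity of the block sum -/

lemma omegaSeries_add_le {s r : ℝ} (hr : 0 ≤ r) {k : ℕ} (hk : 0 < k) :
    omegaSeries (s + r) k ≤ ENNReal.ofReal (2 ^ (-r)) * omegaSeries s k := by
  rw [omegaSeries, omegaSeries, ← ENNReal.tsum_mul_left]
  refine ENNReal.tsum_le_tsum fun n => ?_
  split_ifs with h
  · have hn : 1 < n := ArithmeticFunction.cardFactors_pos_iff_one_lt.mp (h.2 ▸ hk)
    have hn2 : (2 : ℝ) ≤ n := by exact_mod_cast hn
    rw [← ENNReal.ofReal_mul (by positivity)]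
    apply ENNReal.ofReal_le_ofReal
    rw [neg_add, Real.rpow_add (by linarith), mul_comm]
    exact mul_le_mul_of_nonneg_right
      (Real.rpow_le_rpow_of_nonpos two_pos hn2 (by linarith)) (by positivity)
  · simp

/-- Every n involved is at least 2. Stated in [0, ∞], it also covers exponents where the sum
diverges, so uniqueness holds among all real σ. -/
lemma omegaBlockSum_add_le {σ r : ℝ} (hr : 0 ≤ r) :
    omegaBlockSum (σ + r) ≤ ENNReal.ofReal (2 ^ (-r)) * omegaBlockSum σ := by
  rw [omegaBlockSum_eq, omegaBlockSum_eq, ← ENNReal.tsum_mul_left]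
  refine ENNReal.tsum_le_tsum fun k => ?_
  rw [mul_add]
  refine (ENNReal.rpow_le_rpow (omegaSeries_add_le (by positivity) k.succ_pos)
    (by norm_num)).trans ?_
  rw [ENNReal.mul_rpow_of_nonneg _ _ (by norm_num),
    ENNReal.ofReal_rpow_of_nonneg (by positivity) (by norm_num), ← Real.rpow_mul two_pos.le,
    show -(2 * r) * (1 / 2) = -r by ring]

lemma omegaBlockSum_lt_one_of_lt {σ τ : ℝ} (h : σ < τ) (hσ : omegaBlockSum σ = 1) :
    omegaBlockSum τ < 1 := by
  have := omegaBlockSum_add_le (σ := σ) (sub_nonneg.mpr h.le)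
  rw [add_sub_cancel, hσ, mul_one] at this
  refine this.trans_lt ?_
  rw [ENNReal.ofReal_lt_one]
  exact Real.rpow_lt_one_of_one_lt_of_neg one_lt_two (by linarith)

/-- The terms of `omegaSeries`, as real numbers. -/
noncomputable def omegaTerm (k n : ℕ) (s : ℝ) : ℝ :=
  if n ≠ 0 ∧ Ω n = k then (n : ℝ) ^ (-s) else 0

lemma omegaTerm_nonneg (k n : ℕ) (s : ℝ) : 0 ≤ omegaTerm k n s := by
  unfold omegaTerm; split_ifs <;> positivity

lemma two_pow_cardFactors_le {n : ℕ} (hn : n ≠ 0) : 2 ^ Ω n ≤ n := by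
  induction n using Nat.recOnMul with
  | zero => exact absurd rfl hn
  | one => simp
  | prime p hp => rw [ArithmeticFunction.cardFactors_apply_prime hp]; simpa using hp.two_le
  | mul a b iha ihb =>
    have ha := left_ne_zero_of_mul hn
    have hb := right_ne_zero_of_mul hn
    rw [ArithmeticFunction.cardFactors_mul ha hb, pow_add]
    exact Nat.mul_le_mul (iha ha) (ihb hb)

/-- Of the exponent, 1/2 is spent on geometric decay in k through 2^Ω(n) ≤ n, and 3/2 keeps the sum
over n convergent. The majorant is uniform in s ≥ 2, so both summations preserve continuity. -/
lemma omegaTerm_le {s : ℝ} (hs : 2 ≤ s) (k n : ℕ) :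
    omegaTerm k n s ≤ ((2 : ℝ) ^ (-(1 / 2) : ℝ)) ^ k * (n : ℝ) ^ (-(3 / 2) : ℝ) := by
  unfold omegaTerm
  split_ifs with h
  · have hn : (1 : ℝ) ≤ n := by exact_mod_cast Nat.one_le_iff_ne_zero.mpr h.1
    have hk : (2 : ℝ) ^ k ≤ n := by exact_mod_cast h.2 ▸ two_pow_cardFactors_le h.1
    calc (n : ℝ) ^ (-s) ≤ (n : ℝ) ^ (-(1 / 2) + -(3 / 2) : ℝ) :=
          Real.rpow_le_rpow_of_exponent_le hn (by linarith)
      _ = (n : ℝ) ^ (-(1 / 2) : ℝ) * (n : ℝ) ^ (-(3 / 2) : ℝ) := Real.rpow_add (by linarith) _ _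
      _ ≤ ((2 : ℝ) ^ k) ^ (-(1 / 2) : ℝ) * (n : ℝ) ^ (-(3 / 2) : ℝ) :=
          mul_le_mul_of_nonneg_right
            (Real.rpow_le_rpow_of_nonpos (by positivity) hk (by norm_num)) (by positivity)
      _ = _ := by
          rw [← Real.rpow_natCast, ← Real.rpow_natCast, ← Real.rpow_mul two_pos.le,
            ← Real.rpow_mul two_pos.le, mul_comm (k : ℝ)]
  · positivity

lemma summable_omegaTerm_bound (k : ℕ) :
    Summable fun n : ℕ => ((2 : ℝ) ^ (-(1 / 2) : ℝ)) ^ k * (n : ℝ) ^ (-(3 / 2) : ℝ) :=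
  (Real.summable_nat_rpow.mpr (by norm_num)).mul_left _

lemma summable_omegaTerm {s : ℝ} (hs : 2 ≤ s) (k : ℕ) : Summable fun n => omegaTerm k n s :=
  Summable.of_nonneg_of_le (fun n => omegaTerm_nonneg k n s) (fun n => omegaTerm_le hs k n)
    (summable_omegaTerm_bound k)

lemma continuousOn_tsum_omegaTerm (k : ℕ) :
    ContinuousOn (fun s => ∑' n, omegaTerm k n s) (Set.Ici 2) := by
  refine continuousOn_tsum (fun n => ?_) (summable_omegaTerm_bound k) fun n s hs => ?_
  · unfold omegaTerm
    split_ifs with h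
    · have : (n : ℝ) ≠ 0 := by exact_mod_cast h.1
      exact ((Real.continuous_const_rpow this).comp continuous_neg).continuousOn
    · exact continuousOn_const
  · rw [Real.norm_of_nonneg (omegaTerm_nonneg k n s)]
    exact omegaTerm_le hs k n

lemma omegaSeries_eq_ofReal {s : ℝ} (hs : 2 ≤ s) (k : ℕ) :
    omegaSeries s k = ENNReal.ofReal (∑' n, omegaTerm k n s) := by
  rw [ENNReal.ofReal_tsum_of_nonneg (fun n => omegaTerm_nonneg k n s) (summable_omegaTerm hs k),
    omegaSeries]
  refine tsum_congr fun n => ?_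
  unfold omegaTerm
  split_ifs <;> simp

lemma exists_sqrt_tsum_omegaTerm_le : ∃ c C : ℝ, 0 ≤ c ∧ c < 1 ∧ ∀ (k : ℕ) (s : ℝ), 2 ≤ s →
    √(∑' n, omegaTerm k n s) ≤ c ^ k * C := by
  set c : ℝ := (2 : ℝ) ^ (-(1 / 2) : ℝ) with hc
  have hc0 : 0 ≤ c := by positivity
  have hc1 : c < 1 := Real.rpow_lt_one_of_one_lt_of_neg one_lt_two (by norm_num)
  refine ⟨√c, √(∑' n : ℕ, (n : ℝ) ^ (-(3 / 2) : ℝ)), Real.sqrt_nonneg _, ?_, fun k s hs => ?_⟩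
  · rw [Real.sqrt_lt' one_pos]; simpa using hc1
  · rw [Real.sqrt_le_left (by positivity), mul_pow, ← pow_mul, mul_comm k, pow_mul,
      Real.sq_sqrt hc0, Real.sq_sqrt (tsum_nonneg fun n => by positivity), ← tsum_mul_left]
    exact (summable_omegaTerm hs k).tsum_le_tsum (fun n => omegaTerm_le hs k n)
      (summable_omegaTerm_bound k)

lemma continuousOn_tsum_sqrt_omegaTerm :
    ContinuousOn (fun s => ∑' k : ℕ, √(∑' n, omegaTerm (k + 1) n s)) (Set.Ici 2) := by
  obtain ⟨c, C, hc0, hc1, hle⟩ := exists_sqrt_tsum_omegaTerm_le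
  refine continuousOn_tsum (u := fun k => c ^ (k + 1) * C)
    (fun k => (continuousOn_tsum_omegaTerm (k + 1)).sqrt) ?_ fun k s hs => ?_
  · exact ((summable_nat_add_iff 1).mpr (summable_geometric_of_lt_one hc0 hc1)).mul_right C
  · rw [Real.norm_of_nonneg (Real.sqrt_nonneg _)]
    exact hle (k + 1) s hs

lemma omegaBlockSum_eq_ofReal {σ : ℝ} (hσ : 1 ≤ σ) :
    omegaBlockSum σ = ENNReal.ofReal (∑' k : ℕ, √(∑' n, omegaTerm (k + 1) n (2 * σ))) := by
  obtain ⟨c, C, hc0, hc1, hle⟩ := exists_sqrt_tsum_omegaTerm_le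
  have hs : (2 : ℝ) ≤ 2 * σ := by linarith
  have hsum : Summable fun k : ℕ => √(∑' n, omegaTerm (k + 1) n (2 * σ)) :=
    Summable.of_nonneg_of_le (fun k => Real.sqrt_nonneg _) (fun k => hle (k + 1) _ hs)
      (((summable_nat_add_iff 1).mpr (summable_geometric_of_lt_one hc0 hc1)).mul_right C)
  rw [omegaBlockSum_eq, ENNReal.ofReal_tsum_of_nonneg (fun k => Real.sqrt_nonneg _) hsum]
  refine tsum_congr fun k => ?_
  rw [omegaSeries_eq_ofReal hs, Real.sqrt_eq_rpow,
    ENNReal.ofReal_rpow_of_nonneg (tsum_nonneg fun n => omegaTerm_nonneg _ n _) (by norm_num)]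

lemma cardFactors_two_pow_mul_three_pow (i j : ℕ) : Ω (2 ^ i * 3 ^ j) = i + j := by
  rw [ArithmeticFunction.cardFactors_mul (by positivity) (by positivity),
    ArithmeticFunction.cardFactors_apply_prime_pow Nat.prime_two,
    ArithmeticFunction.cardFactors_apply_prime_pow Nat.prime_three]

lemma ofReal_le_omegaSeries_two_rpow_half {k : ℕ} {S : Finset ℕ} (hS : ∀ n ∈ S, n ≠ 0 ∧ Ω n = k)
    {y : ℝ} (hy : 0 ≤ y) (h : y ^ 2 ≤ ∑ n ∈ S, ((n : ℝ)⁻¹) ^ 2) :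
    ENNReal.ofReal y ≤ omegaSeries (2 * 1) k ^ (1 / 2 : ℝ) := by
  rw [← ofReal_sq_rpow_half hy]
  gcongr
  refine le_trans (ENNReal.ofReal_le_ofReal h) ?_
  have := ofReal_sum_rpow_sq_le_omegaSeries (σ := 1) hS
  simpa only [Real.rpow_neg_one] using this

/-- The integers 2, 3; 4, 6, 9; 8, 12 in the first three blocks already give 0.6 + 0.32 + 0.14 > 1.
-/
lemma one_le_omegaBlockSum_one : 1 ≤ omegaBlockSum 1 := by
  have h42 := cardFactors_two_pow_mul_three_pow 2 0
  have h62 := cardFactors_two_pow_mul_three_pow 1 1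
  have h92 := cardFactors_two_pow_mul_three_pow 0 2
  have h83 := cardFactors_two_pow_mul_three_pow 3 0
  have h123 := cardFactors_two_pow_mul_three_pow 2 1
  norm_num only at h42 h62 h92 h83 h123
  have b1 : ENNReal.ofReal 0.6 ≤ omegaSeries (2 * 1) (0 + 1) ^ (1 / 2 : ℝ) :=
    ofReal_le_omegaSeries_two_rpow_half (S := {2, 3}) (by simp [Nat.prime_two, Nat.prime_three]) (by norm_num)
      (by norm_num)
  have b2 : ENNReal.ofReal 0.32 ≤ omegaSeries (2 * 1) (1 + 1) ^ (1 / 2 : ℝ) :=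
    ofReal_le_omegaSeries_two_rpow_half (S := {4, 6, 9}) (by simp [h42, h62, h92]) (by norm_num)
      (by norm_num)
  have b3 : ENNReal.ofReal 0.14 ≤ omegaSeries (2 * 1) (2 + 1) ^ (1 / 2 : ℝ) :=
    ofReal_le_omegaSeries_two_rpow_half (S := {8, 12}) (by simp [h83, h123]) (by norm_num)
      (by norm_num)
  rw [omegaBlockSum_eq]
  calc (1 : ENNReal) ≤ ENNReal.ofReal 0.6 + ENNReal.ofReal 0.32 + ENNReal.ofReal 0.14 := by
        rw [← ENNReal.ofReal_add (by norm_num) (by norm_num),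
          ← ENNReal.ofReal_add (by norm_num) (by norm_num), ENNReal.one_le_ofReal]
        norm_num
    _ ≤ ∑ k ∈ Finset.range 3, omegaSeries (2 * 1) (k + 1) ^ (1 / 2 : ℝ) := by
        rw [Finset.sum_range_succ, Finset.sum_range_succ, Finset.sum_range_one]
        gcongr
    _ ≤ _ := ENNReal.sum_le_tsum _

lemma exists_omegaBlockSum_eq_one : ∃ σ : ℝ, σ ≤ 345 / 286 ∧ omegaBlockSum σ = 1 := by
  set G : ℝ → ℝ := fun s => ∑' k : ℕ, √(∑' n, omegaTerm (k + 1) n s) with hG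
  have h1 : 1 ≤ G (2 * 1) := by
    have := one_le_omegaBlockSum_one
    rwa [omegaBlockSum_eq_ofReal le_rfl, ENNReal.one_le_ofReal] at this
  have h2 : G (2 * (345 / 286)) ≤ 1 := by
    have := omegaBlockSum_lt_one.le
    rwa [omegaBlockSum_eq_ofReal (by norm_num), ENNReal.ofReal_le_one] at this
  have hc : ContinuousOn (fun σ => G (2 * σ)) (Set.Icc 1 (345 / 286)) :=
    continuousOn_tsum_sqrt_omegaTerm.comp (by fun_prop) fun σ hσ =>
      show 2 ≤ 2 * σ by linarith [hσ.1]
  obtain ⟨σ, hσ, hGσ⟩ := intermediate_value_Icc' (by norm_num) hc ⟨h2, h1⟩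
  refine ⟨σ, hσ.2, ?_⟩
  rw [omegaBlockSum_eq_ofReal hσ.1]
  exact (congrArg ENNReal.ofReal hGσ).trans ENNReal.ofReal_one

theorem theorem3p3 :
    (∃ σ₀ : ℝ, (∀ σ : ℝ, omegaBlockSum σ = 1 ↔ σ = σ₀) ∧
      σ₀ < 1.2063 ∧ σ₀ ∈ admissibleExponents) ∧
    (∃ σopt : ℝ, IsLeast admissibleExponents σopt ∧ 1 ≤ σopt ∧ σopt < 1.2061) ∧
    IsLeast admissibleExponentsPowersOfTwo 1 := by
  refine ⟨?_, ?_, isLeast_admissibleExponentsPowersOfTwo⟩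
  · obtain ⟨σ₀, hle, h⟩ := exists_omegaBlockSum_eq_one
    refine ⟨σ₀, fun σ => ⟨fun hσ => ?_, fun hσ => hσ ▸ h⟩, hle.trans_lt (by norm_num),
      mem_admissibleExponents_of_omegaBlockSum_le_one h.le⟩
    rcases lt_trichotomy σ σ₀ with hlt | heq | hgt
    · exact absurd h (omegaBlockSum_lt_one_of_lt hlt hσ).ne
    · exact heq
    · exact absurd hσ (omegaBlockSum_lt_one_of_lt hgt h).ne
  · obtain ⟨τ, hτ, h1, hle⟩ := exists_isLeast_admissibleExponents sixFifths_mem_admissibleExponents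
    exact ⟨τ, hτ, h1, hle.trans_lt (by norm_num)⟩
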